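/- Let $G$ be a compact, second countable Hausdorff group (for example a compact Lie group or a finite group) with normalized Haar measure $\mu_G$. Let $(S_t)_{t\ge 0}$ be a strongly continuous Markov semigroup on the bounded measurable functions on $G$, $S_0=\mathrm{id}$, with a measurable right-invariant kernel, $S_t f(g)=\int_G k_t(g,h)f(h)\,d\mu_G(h)$, $k_t\ge 0$, $k_t(ga,ha)=k_t(g,h)$, for all $t>0$ (and also for $t=0$ if $G$ is finite), and write $k_t(g)=k_t(g,e)$. Let $g\mapsto u(g)$ be a continuous projective unitary representation of $G$ on a finite-dimensional Hilbert space $\mathcal H$ (that is, $u(gh)$ equals $u(g)u(h)$ up to a phase and $g\mapsto u(g)^*xu(g)$ is continuous for all $x$), and let $(T_t)_{t\ge0}$ be the transferred quantum Markov semigroup $$T_t(x)=\int_G k_t(g^{-1})\,u(g)^*x\,u(g)\,d\mu_G(g)\quad(t>0),\qquad T_0=\mathrm{id}.$$ Let $N_{fix}=\{x\in\mathcal B(\mathcal H): T_t(x)=x\ \forall t\ge0\}$, let $E_{fix}$ be the orthogonal projection of $\mathcal B(\mathcal H)$ onto $N_{fix}$ for the inner product $\operatorname{Tr}(x^*y)$,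 and let $\mathcal D(N_{fix})$ be the set of density matrices $\sigma$ with $E_{fix}(\sigma)=\sigma$. For density matrices $\rho,\sigma$ with $\ker\sigma\subseteq\ker\rho$ put, with logarithms and negative powers taken on supports, $$D_p(\rho\|\sigma)=\tfrac1{p-1}\log\operatorname{Tr}\big[(\sigma^{\frac{1-p}{2p}}\rho\,\sigma^{\frac{1-p}{2p}})^p\big]\ (1<p<\infty),\quad D(\rho\|\sigma)=\operatorname{Tr}\rho(\log\rho-\log\sigma),\quad D_\infty(\rho\|\sigma)=\log\|\sigma^{-1/2}\rho\,\sigma^{-1/2}\|_\infty ,$$ and let all of them be $+\infty$ if $\ker\sigma\not\subseteq\ker\rho$. Let $\epsilon>0$ be such that the set of $t\ge0$ for which $k_t$ exists and $\|k_t-1\|_{L_\infty(\mu_G)}\le\epsilon$ is non-empty, let $t(\epsilon)$ be the infimum of this set, and write $t=t(\epsilon)$. Then for every $\sigma\in\mathcal D(N_{fix})$ and every density matrix $\rho$ on $\mathcal H$: 1. for every $p\in(1,\infty)$, $$D_p(E_{fix}(\rho)\|\sigma)\le D_p(T_{t}(\rho)\|\sigma)\le D_p(E_{fix}(\rho)\|\sigma)+\tfrac{p}{p-1}\log\|k_{t}\|_{L_p(\mu_G)}\le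 D_p(E_{fix}(\rho)\|\sigma)+\log(1+\epsilon);$$ 2. (the case $p=1$) $k_t\log k_t$ is integrable and $$D(E_{fix}(\rho)\|\sigma)\le D(T_{t}(\rho)\|\sigma)\le D(E_{fix}(\rho)\|\sigma)+\int_G k_{t}\log k_{t}\,d\mu_G\le D(E_{fix}(\rho)\|\sigma)+\log(1+\epsilon);$$ 3. (the case $p=\infty$) $$D_\infty(E_{fix}(\rho)\|\sigma)\le D_\infty(T_{t}(\rho)\|\sigma)\le D_\infty(E_{fix}(\rho)\|\sigma)+\log\|k_{t}\|_{L_\infty(\mu_G)}\le D_\infty(E_{fix}(\rho)\|\sigma)+\log(1+\epsilon).$$ -/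

import Mathlib

open MeasureTheory Topology Filter
open scoped NNReal ENNReal Matrix ComplexOrder Matrix.Norms.L2Operator

noncomputable section

namespace TransferredQMS

variable {G : Type*} [Group G] [TopologicalSpace G] [MeasurableSpace G]
variable {n : Type*} [Fintype n] [DecidableEq n]

/-- The times at which the transition probabilities of a semigroup on `G` are asked to have a
density: all `t > 0`, and also `t = 0` when `G` is finite. (On an infinite compact group
`S₀ = id` has no density with respect to the Haar measure.) -/
def IsKernelTime (G : Type*) (t : ℝ≥0) : Prop := 0 < t ∨ Finite G

/-- The operator `S_t f (g) = ∫ K t g h * f h dμ(h)` for `t > 0`, and `S_0 = id`. -/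
def kernelOp (μ : Measure G) (K : ℝ≥0 → G → G → ℝ) (t : ℝ≥0) (f : G → ℝ) (g : G) : ℝ :=
  if t = 0 then f g else ∫ h, K t g h * f h ∂μ

/-- A (strongly continuous) right-invariant Markov semigroup `(S_t)` on the bounded measurable
functions of the compact group `G`, with kernel `k_t(g,h)` with respect to `μ`
(the normalized Haar measure in the applications). -/
structure MarkovSemigroup (μ : Measure G) where
  /-- the kernel `k_t(g,h)`; its values at `t = 0` are only meaningful for finite `G` -/
  K : ℝ≥0 → G → G → ℝ
  measurable : ∀ t, 0 < t → Measurable (Function.uncurry (K t))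
  nonneg : ∀ t, 0 < t → ∀ g h, 0 ≤ K t g h
  /-- `S_t 1 = 1` -/
  mass : ∀ t, 0 < t → ∀ g, ∫ h, K t g h ∂μ = 1
  right_invariant : ∀ t, 0 < t → ∀ g h a, K t (g * a) (h * a) = K t g h
  /-- `S_{s+t} = S_s S_t` on bounded measurable functions -/
  semigroup : ∀ s t, ∀ f : G → ℝ, Measurable f → (∃ C, ∀ g, |f g| ≤ C) →
    ∀ g, kernelOp μ K (s + t) f g = kernelOp μ K s (kernelOp μ K t f) g
  /-- strong continuity at `0` -/
  continuous : ∀ f : G → ℝ, Continuous f → ∀ g,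
    Tendsto (fun t => kernelOp μ K t f g) (𝓝[>] 0) (𝓝 (f g))
  /-- on a finite group, the kernel at time `0` represents `S_0 = id` -/
  zero : Finite G → ∀ (f : G → ℝ) g, ∫ h, K 0 g h * f h ∂μ = f g

/-- The convolution kernel `k_t(g) = k_t(g, e)`. -/
def MarkovSemigroup.k {μ : Measure G} (S : MarkovSemigroup μ) (t : ℝ≥0) (g : G) : ℝ := S.K t g 1

/-- The set of times at which `‖k_t - 1‖_∞ ≤ ε`. -/
def MarkovSemigroup.mixingTimes {μ : Measure G} (S : MarkovSemigroup μ) (ε : ℝ) : Set ℝ≥0 :=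
  {t | IsKernelTime G t ∧ eLpNorm (fun g => S.k t g - 1) ∞ μ ≤ ENNReal.ofReal ε}

/-- `t(ε) = inf {t ≥ 0 | ‖k_t - 1‖_∞ ≤ ε}` (meaningful when the set is non-empty). -/
def MarkovSemigroup.tEps {μ : Measure G} (S : MarkovSemigroup μ) (ε : ℝ) : ℝ≥0 :=
  sInf (S.mixingTimes ε)

/-- A (continuous, unitary) projective representation of `G` on `ℂⁿ`: unitaries `u(g)` that are
multiplicative up to phases, and that depend continuously on `g` up to phases, that is, the
conjugation `u(g)^* x u(g)` is continuous in `g`. -/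
structure ProjectiveRep (G : Type*) [Group G] [TopologicalSpace G]
    (n : Type*) [Fintype n] [DecidableEq n] where
  u : G → Matrix n n ℂ
  unitary : ∀ g, u g ∈ Matrix.unitaryGroup n ℂ
  mul : ∀ g h, ∃ c : ℂ, ‖c‖ = 1 ∧ u (g * h) = c • (u g * u h)
  continuous : ∀ x : Matrix n n ℂ, Continuous fun g => (u g)ᴴ * x * u g

/-- `T_t(x) = ∫ k_t(g⁻¹) u(g)^* x u(g) dμ(g)` for `t > 0`, and `T_0 = id`, as a function. -/
def transferredFun {μ : Measure G} (S : MarkovSemigroup μ) (U : ProjectiveRep G n)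
    (t : ℝ≥0) (x : Matrix n n ℂ) : Matrix n n ℂ :=
  if t = 0 then x else ∫ g, ((S.k t g⁻¹ : ℝ) : ℂ) • ((U.u g)ᴴ * x * U.u g) ∂μ

theorem MarkovSemigroup.integrable_k_inv {μ : Measure G} (S : MarkovSemigroup μ) {t : ℝ≥0} (ht : 0 < t) :
    Integrable (fun g => S.k t g⁻¹) μ := by
  have h1 : Integrable (fun h => S.K t 1 h) μ := by
    by_contra hc
    have := S.mass t ht 1
    rw [integral_undef hc] at this
    exact zero_ne_one this
  refine h1.congr (Eventually.of_forall fun h => ?_)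
  have := S.right_invariant t ht 1 h h⁻¹
  simpa [MarkovSemigroup.k] using this.symm

section linear

variable [IsTopologicalGroup G] [CompactSpace G] [SecondCountableTopology G] [BorelSpace G]
variable {μ : Measure G} [μ.IsHaarMeasure] [IsProbabilityMeasure μ]

theorem integrable_transferred (S : MarkovSemigroup μ) (U : ProjectiveRep G n) {t : ℝ≥0}
    (ht : 0 < t) (x : Matrix n n ℂ) :
    Integrable (fun g => ((S.k t g⁻¹ : ℝ) : ℂ) • ((U.u g)ᴴ * x * U.u g)) μ := by
  have hk : Integrable (fun g => ((S.k t g⁻¹ : ℝ) : ℂ)) μ := (S.integrable_k_inv ht).ofReal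
  obtain ⟨C, hC⟩ := isCompact_univ.exists_bound_of_continuousOn (U.continuous x).continuousOn
  exact hk.smul_bdd C (U.continuous x).aestronglyMeasurable
    (Eventually.of_forall fun g => hC g (Set.mem_univ g))

/-- The transferred quantum Markov semigroup `(T_t)` of the semigroup `S` and the projective
representation `U`, as linear maps on the `n × n` matrices. -/
def transferred (S : MarkovSemigroup μ) (U : ProjectiveRep G n) (t : ℝ≥0) :
    Matrix n n ℂ →ₗ[ℂ] Matrix n n ℂ where
  toFun := transferredFun S U t
  map_add' x y := by
    rcases eq_or_ne t 0 with rfl | ht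
    · simp [transferredFun]
    · have ht' : 0 < t := pos_iff_ne_zero.2 ht
      simp only [transferredFun, if_neg ht]
      rw [← integral_add (integrable_transferred S U ht' x) (integrable_transferred S U ht' y)]
      simp [mul_add, add_mul]
  map_smul' c x := by
    rcases eq_or_ne t 0 with rfl | ht
    · simp [transferredFun]
    · simp only [transferredFun, if_neg ht, RingHom.id_apply]
      rw [← integral_smul]
      refine integral_congr_ae (Eventually.of_forall fun g => ?_)
      simp [smul_comm c]

/-- The fixed points `N_fix = {x | T_t(x) = x for all t ≥ 0}`. -/
def Nfix (S : MarkovSemigroup μ) (U : ProjectiveRep G n) : Submodule ℂ (Matrix n n ℂ) where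
  carrier := {x | ∀ t, transferred S U t x = x}
  add_mem' hx hy t := by rw [map_add, hx t, hy t]
  zero_mem' t := map_zero _
  smul_mem' c x hx t := by rw [map_smul, hx t]

end linear

/-- Matrices as vectors of entries with the Euclidean (Hilbert–Schmidt) inner product. -/
def hsEquiv (n : Type*) [Fintype n] : Matrix n n ℂ ≃ₗ[ℂ] EuclideanSpace ℂ (n × n) :=
  (LinearEquiv.curry ℂ ℂ n n).symm ≪≫ₗ (WithLp.linearEquiv 2 ℂ (n × n → ℂ)).symm

theorem inner_hsEquiv {n : Type*} [Fintype n] (x y : Matrix n n ℂ) :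
    inner ℂ (hsEquiv n x) (hsEquiv n y) = (xᴴ * y).trace := by
  simp only [PiLp.inner_apply, hsEquiv, Matrix.trace, Matrix.diag, Matrix.mul_apply,
    Fintype.sum_prod_type]
  rw [Finset.sum_comm]
  refine Finset.sum_congr rfl fun i _ => Finset.sum_congr rfl fun j _ => ?_
  rw [Matrix.conjTranspose_apply, mul_comm]
  rfl

/-- The orthogonal projection onto a subspace of matrices for the Hilbert–Schmidt inner product
`⟨x, y⟩ = Tr (x^* y)`. -/
def hsProj {n : Type*} [Fintype n] (N : Submodule ℂ (Matrix n n ℂ)) : Matrix n n ℂ →ₗ[ℂ] Matrix n n ℂ :=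
  (hsEquiv n).symm.toLinearMap ∘ₗ
    (N.map (hsEquiv n).toLinearMap).starProjection.toLinearMap ∘ₗ (hsEquiv n).toLinearMap

theorem hsProj_mem {n : Type*} [Fintype n] (N : Submodule ℂ (Matrix n n ℂ)) (x : Matrix n n ℂ) : hsProj N x ∈ N := by
  obtain ⟨y, hy, hxy⟩ := Submodule.starProjection_apply_mem
    (N.map (hsEquiv n).toLinearMap) (hsEquiv n x)
  have : hsProj N x = y := by
    simp only [hsProj, LinearMap.comp_apply, LinearEquiv.coe_coe, ContinuousLinearMap.coe_coe]
    rw [← hxy]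
    simp
  rwa [this]

theorem hsProj_orthogonal {n : Type*} [Fintype n] (N : Submodule ℂ (Matrix n n ℂ)) (x y : Matrix n n ℂ) (hy : y ∈ N) :
    (yᴴ * (x - hsProj N x)).trace = 0 := by
  rw [← inner_hsEquiv, map_sub]
  have h := Submodule.sub_starProjection_mem_orthogonal
    (K := N.map (hsEquiv n).toLinearMap) (hsEquiv n x)
  have := (Submodule.mem_orthogonal _ _).1 h (hsEquiv n y) ⟨y, hy, rfl⟩
  simpa only [hsProj, LinearMap.comp_apply, LinearEquiv.coe_coe, ContinuousLinearMap.coe_coe,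
    LinearEquiv.apply_symm_apply] using this

/-- Density matrices. -/
def IsState (ρ : Matrix n n ℂ) : Prop := ρ.PosSemidef ∧ ρ.trace = 1

section fix

variable [IsTopologicalGroup G] [CompactSpace G] [SecondCountableTopology G] [BorelSpace G]
variable {μ : Measure G} [μ.IsHaarMeasure] [IsProbabilityMeasure μ]

/-- `E_fix`, the orthogonal projection onto `N_fix` for the Hilbert–Schmidt inner product. -/
def Efix (S : MarkovSemigroup μ) (U : ProjectiveRep G n) : Matrix n n ℂ →ₗ[ℂ] Matrix n n ℂ :=
  hsProj (Nfix S U)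

/-- `𝒟(N_fix)`: the density matrices `σ` with `E_fix(σ) = σ`. -/
def IsFixState (S : MarkovSemigroup μ) (U : ProjectiveRep G n) (σ : Matrix n n ℂ) : Prop :=
  IsState σ ∧ Efix S U σ = σ

end fix

/-- The real power `a ^ s` of a positive semidefinite matrix, with `0 ^ s = 0` for `s ≠ 0`
(so that negative powers are taken on the support). -/
def mpow (a : Matrix n n ℂ) (s : ℝ) : Matrix n n ℂ := cfc (fun x : ℝ => x ^ s) a

/-- The logarithm of a positive semidefinite matrix, taken on its support (`log 0 = 0`). -/
def mlog (a : Matrix n n ℂ) : Matrix n n ℂ := cfc Real.log a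

/-- `ker σ ⊆ ker ρ`. -/
def KerLE (σ ρ : Matrix n n ℂ) : Prop := ∀ v : n → ℂ, σ *ᵥ v = 0 → ρ *ᵥ v = 0

open Classical in
/-- The sandwiched Rényi divergence `D_p(ρ‖σ)` for `p ∈ (1, ∞)`. -/
def sandwichedRenyi (p : ℝ) (ρ σ : Matrix n n ℂ) : EReal :=
  if KerLE σ ρ then
    ((1 / (p - 1) * Real.log (mpow (mpow σ ((1 - p) / (2 * p)) * ρ *
      mpow σ ((1 - p) / (2 * p))) p).trace.re : ℝ) : EReal)
  else ⊤

open Classical in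
/-- `D_∞(ρ‖σ) = log ‖σ^{-1/2} ρ σ^{-1/2}‖_∞`, with the operator norm. -/
def maxRenyi (ρ σ : Matrix n n ℂ) : EReal :=
  if KerLE σ ρ then
    ((Real.log ‖mpow σ (-(1 / 2)) * ρ * mpow σ (-(1 / 2))‖ : ℝ) : EReal)
  else ⊤

open Classical in
/-- The quantum relative entropy `D(ρ‖σ) = Tr ρ (log ρ - log σ)`. -/
def relEntropy (ρ σ : Matrix n n ℂ) : EReal :=
  if KerLE σ ρ then (((ρ * (mlog ρ - mlog σ)).trace.re : ℝ) : EReal) else ⊤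

end TransferredQMS

end

set_option linter.unusedSectionVars false

noncomputable section

namespace TransferredQMS

variable {G : Type*} [Group G] [TopologicalSpace G] [MeasurableSpace G]
variable {n : Type*} [Fintype n] [DecidableEq n]

/-! ### Complex powers of positive matrices and the three lines theorem -/

/-! Write κ(g) = k_t(g⁻¹), so that T = T_t is the κ-average of the conjugations x ↦ u(g)^* x u(g).
If T x = x, then ∫ κ(g) ‖u(g)^* x u(g) − x‖² dμ = 2‖x‖² − 2 Re⟨x, T x⟩ = 0 in the Hilbert–Schmidt
norm, so x is fixed by almost every g with κ(g) ≠ 0. Hence the pointwise stabiliser H of N_fix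
(`fixSet`) is a closed subgroup that carries every density κ. It has positive measure, N_fix is
exactly the set of H-invariant matrices, and E = E_fix is the average over H with density 1_H / μ(H)
(`ae_mem_fixSet`, `mem_Nfix_iff`, `Efix_eq_actAverage`).

It follows that E T = E and that T and E are bimodule maps over the H-invariant matrices. Functions
of a fixed state σ are H-invariant, so powers of σ pass through T and E. For p > 1 everything
reduces to ‖E X‖_p ≤ ‖T X‖_p ≤ ‖κ‖_p ‖E X‖_p with X = σ^s ρ σ^s ≥ 0.

The left inequality says that E is an L_p contraction, applied to T X. This comes from Young's
inequality under the trace (`trace_mpow_Efix_le`). For the right one, κ is dominated by a simple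
function ∑ c_j 1_{A_j} with A_j ⊆ H. The pieces X_j, averages of X over A_j, satisfy ∑ X_j ≤ E X
because μ(H) ≤ 1. The three lines theorem then gives Tr (∑ c_j X_j)^p ≤ ∑ c_j^p Tr (B^{p-1} X_j) for
a positive definite B ≥ ∑ X_j (`trace_mpow_sum_le`). With B close to E X, invariance of B turns the
right side into ∑ c_j^p μ(A_j) Tr (B^{p-1} X), and approximation finishes (`trace_mpow_average_le`).

The case p = 1 is the derivative of these inequalities at p = 1, where both sides agree. The case p
= ∞ follows from κ ≤ M 1_H / μ(H) when κ ≤ M. The bounds by log(1+ε) need ‖k_t − 1‖_∞ ≤ ε at t =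
t(ε) itself, so the infimum has to be attained: right continuity of the semigroup, tested on
continuous functions, gives this (`tEps_mem_mixingTimes`). -/

/-- The complex power `U diag(b)^w U^*` of the positive definite matrix `U diag(b) U^*`. -/
def diagCpow (U : Matrix n n ℂ) (b : n → ℝ) (w : ℂ) : Matrix n n ℂ :=
  U * Matrix.diagonal (fun k => Complex.exp (w * Real.log (b k))) * Uᴴ

theorem diagCpow_conjTranspose (U : Matrix n n ℂ) (b : n → ℝ) (w : ℂ) :
    (diagCpow U b w)ᴴ = diagCpow U b (star w) := by
  simp only [diagCpow, Matrix.conjTranspose_mul, Matrix.conjTranspose_conjTranspose,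
    Matrix.diagonal_conjTranspose, Matrix.mul_assoc]
  congr 3
  ext k
  simp [← Complex.exp_conj]

theorem diagCpow_mul {U : Matrix n n ℂ} (hU : Uᴴ * U = 1) (b : n → ℝ) (w w' : ℂ) :
    diagCpow U b w * diagCpow U b w' = diagCpow U b (w + w') := by
  have : ∀ D D' : Matrix n n ℂ, U * D * Uᴴ * (U * D' * Uᴴ) = U * (D * D') * Uᴴ := by
    intro D D'
    calc U * D * Uᴴ * (U * D' * Uᴴ) = U * D * (Uᴴ * U) * D' * Uᴴ := by
          simp only [Matrix.mul_assoc]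
      _ = _ := by rw [hU]; simp only [Matrix.mul_assoc, Matrix.mul_one]
  rw [diagCpow, diagCpow, diagCpow, this, Matrix.diagonal_mul_diagonal]
  simp only [add_mul, Complex.exp_add]

theorem diagCpow_zero {U : Matrix n n ℂ} (hU : U * Uᴴ = 1) (b : n → ℝ) :
    diagCpow U b 0 = 1 := by
  simp [diagCpow, hU]

theorem diagCpow_ofReal (U : Matrix n n ℂ) {b : n → ℝ} (hb : ∀ k, 0 < b k) (s : ℝ) :
    diagCpow U b s = U * Matrix.diagonal (fun k => ((b k ^ s : ℝ) : ℂ)) * Uᴴ := by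
  rw [diagCpow]
  congr 3
  ext k
  rw [Real.rpow_def_of_pos (hb k), mul_comm]
  push_cast
  rfl

/-- The arithmetic-geometric mean inequality for the sesquilinear form of a positive
semidefinite matrix. -/
theorem norm_diag_le_of_posSemidef {X : Matrix n n ℂ} (hX : X.PosSemidef) (A C : Matrix n n ℂ)
    (i : n) : ‖(Aᴴ * X * C) i i‖ ≤ ((Aᴴ * X * A) i i).re / 2 + ((Cᴴ * X * C) i i).re / 2 := by
  obtain ⟨Y, rfl⟩ : ∃ Y : Matrix n n ℂ, X = Yᴴ * Y := by
    open scoped MatrixOrder in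
    exact CStarAlgebra.nonneg_iff_eq_star_mul_self.1 (Matrix.nonneg_iff_posSemidef.2 hX)
  have key : ∀ A C : Matrix n n ℂ, (Aᴴ * (Yᴴ * Y) * C) i i =
      ∑ k, star ((Y * A) k i) * (Y * C) k i := by
    intro A C
    have : Aᴴ * (Yᴴ * Y) * C = (Y * A)ᴴ * (Y * C) := by
      rw [Matrix.conjTranspose_mul]
      simp only [Matrix.mul_assoc]
    rw [this, Matrix.mul_apply]
    rfl
  have key2 : ∀ A : Matrix n n ℂ, ((Aᴴ * (Yᴴ * Y) * A) i i).re = ∑ k, ‖(Y * A) k i‖ ^ 2 := by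
    intro A
    rw [key, Complex.re_sum]
    refine Finset.sum_congr rfl fun k _ => ?_
    rw [Complex.star_def, ← Complex.normSq_eq_conj_mul_self, Complex.ofReal_re,
      Complex.normSq_eq_norm_sq]
  rw [key2, key2, key, ← add_div, ← Finset.sum_add_distrib, Finset.sum_div]
  refine (norm_sum_le _ _).trans (Finset.sum_le_sum fun k _ => ?_)
  rw [norm_mul, norm_star]
  nlinarith [sq_nonneg (‖(Y * A) k i‖ - ‖(Y * C) k i‖)]

/-- Entire functions that are bounded on the strip `0 ≤ Re z ≤ 1`. -/
def EntireStripBounded (f : ℂ → ℂ) : Prop :=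
  Differentiable ℂ f ∧ ∃ C, ∀ z : ℂ, 0 ≤ z.re → z.re ≤ 1 → ‖f z‖ ≤ C

namespace EntireStripBounded

theorem const (c : ℂ) : EntireStripBounded fun _ => c :=
  ⟨differentiable_const c, ‖c‖, fun _ _ _ => le_rfl⟩

theorem mul {f g : ℂ → ℂ} (hf : EntireStripBounded f) (hg : EntireStripBounded g) :
    EntireStripBounded fun z => f z * g z := by
  obtain ⟨hf, C, hC⟩ := hf
  obtain ⟨hg, D, hD⟩ := hg
  refine ⟨hf.mul hg, C * D, fun z h0 h1 => ?_⟩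
  rw [norm_mul]
  exact mul_le_mul (hC z h0 h1) (hD z h0 h1) (norm_nonneg _) ((norm_nonneg _).trans (hC z h0 h1))

theorem sum {ι : Type*} {s : Finset ι} {f : ι → ℂ → ℂ} (hf : ∀ i ∈ s, EntireStripBounded (f i)) :
    EntireStripBounded fun z => ∑ i ∈ s, f i z := by
  choose! hd C hC using hf
  exact ⟨Differentiable.fun_sum hd, ∑ i ∈ s, C i, fun z h0 h1 =>
    (norm_sum_le _ _).trans (Finset.sum_le_sum fun i hi => hC i hi z h0 h1)⟩

/-- For real parameters the modulus depends only on `z.re`, so the unbounded imaginary direction of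
the strip does no harm. -/
theorem exp (α β r : ℝ) : EntireStripBounded fun z => Complex.exp ((α * z + β) * r) := by
  refine ⟨by fun_prop, Real.exp ((|α| + |β|) * |r|), fun z h0 h1 => ?_⟩
  rw [Complex.norm_exp, Real.exp_le_exp]
  simp only [Complex.mul_re, Complex.add_re, Complex.ofReal_re, Complex.add_im, Complex.mul_im,
    Complex.ofReal_im, zero_mul, sub_zero, mul_zero]
  refine (le_abs_self _).trans ?_
  rw [abs_mul]
  refine mul_le_mul_of_nonneg_right ((abs_add_le _ _).trans (add_le_add ?_ le_rfl)) (abs_nonneg _)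
  rw [abs_mul, abs_of_nonneg h0]
  exact mul_le_of_le_one_right (abs_nonneg _) h1

theorem matrix_mul {l m o : Type*} [Fintype m] {A : ℂ → Matrix l m ℂ} {B : ℂ → Matrix m o ℂ}
    (hA : ∀ i j, EntireStripBounded fun z => A z i j)
    (hB : ∀ i j, EntireStripBounded fun z => B z i j) (i : l) (j : o) :
    EntireStripBounded fun z => (A z * B z) i j := by
  simp only [Matrix.mul_apply]
  exact sum fun k _ => (hA i k).mul (hB k j)

theorem diagCpow (U : Matrix n n ℂ) (b : n → ℝ) (α β : ℝ) (i j : n) :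
    EntireStripBounded fun z => diagCpow U b (α * z + β) i j := by
  have h : ∀ k l, EntireStripBounded fun z : ℂ => Matrix.diagonal
      (fun k => Complex.exp ((α * z + β) * Real.log (b k))) k l := fun k l => ?_
  · exact matrix_mul (B := fun _ => Uᴴ)
      (matrix_mul (A := fun _ => U) (fun _ _ => const _) h) (fun _ _ => const _) i j
  rcases eq_or_ne k l with rfl | h
  · simpa using exp α β _
  · simpa [Matrix.diagonal_apply_ne _ h] using const 0

/-- The three lines theorem. -/
theorem norm_le {f : ℂ → ℂ} (hf : EntireStripBounded f) {a b : ℝ}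
    (ha : ∀ z : ℂ, z.re = 0 → ‖f z‖ ≤ a) (hb : ∀ z : ℂ, z.re = 1 → ‖f z‖ ≤ b) {s : ℝ}
    (hs0 : 0 ≤ s) (hs1 : s ≤ 1) : ‖f s‖ ≤ a ^ (1 - s) * b ^ s := by
  obtain ⟨hd, C, hC⟩ := hf
  have := Complex.HadamardThreeLines.norm_le_interp_of_mem_verticalClosedStrip' (f := f)
    (z := (s : ℂ)) (l := 0) (u := 1) zero_lt_one ⟨hs0, hs1⟩ hd.diffContOnCl
    ⟨C, by rintro _ ⟨z, ⟨h0, h1⟩, rfl⟩; exact hC z h0 h1⟩ ha hb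
  simpa using this

end EntireStripBounded

/-- A discrete Araki-Lieb-Thirring type inequality in spectral coordinates: if
`∑ X_j ≤ B = U diag(b) U^*` and `∑ c_j X_j = V diag(z) V^*`, then
`∑ z_i^p ≤ ∑ c_j^p Tr (B^{p-1} X_j)`. -/
theorem sum_rpow_le_of_sum_le_diagonal {ι : Type*} [Fintype ι] {U V : Matrix n n ℂ}
    (hU : Uᴴ * U = 1) (hU' : U * Uᴴ = 1) (hV : Vᴴ * V = 1) (hV' : V * Vᴴ = 1) {b z : n → ℝ}
    (hb : ∀ k, 0 < b k) (hz : ∀ i, 0 ≤ z i) {X : ι → Matrix n n ℂ} (hX : ∀ j, (X j).PosSemidef)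
    {c : ι → ℝ} (hc : ∀ j, 0 < c j)
    (hle : (U * Matrix.diagonal (fun k => (b k : ℂ)) * Uᴴ - ∑ j, X j).PosSemidef)
    (hZ : ∑ j, (c j : ℂ) • X j = V * Matrix.diagonal (fun i => (z i : ℂ)) * Vᴴ)
    {p : ℝ} (hp : 1 < p) :
    ∑ i, z i ^ p ≤ ∑ j, c j ^ p * ((diagCpow U b ((p - 1 : ℝ) : ℂ) * X j).trace).re := by
  have hp0 : 0 < p := by linarith
  -- the matrices `V^* B^w X_j B^w V`
  set Q : ℂ → ι → Matrix n n ℂ := fun w j =>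
    Vᴴ * diagCpow U b w * X j * (diagCpow U b w * V) with hQ
  have hQ' : ∀ w j, Q w j = (diagCpow U b (star w) * V)ᴴ * X j * (diagCpow U b w * V) := by
    intro w j
    rw [Matrix.conjTranspose_mul, diagCpow_conjTranspose, star_star]
  -- The interpolating function is f(ξ) = ∑ z_i^{p(1-ξ)} c_j^{pξ} Q(pξ/2 - 1/2)_ii. At ξ = 1/p the
  -- three exponents are p - 1, 1 and 0, so f = ∑ z_i^{p-1} z_i. On the two edges B enters with
  -- exponents of real part -1/2 and (p - 1)/2. Terms with z_i = 0 are cut off because `Real.log 0 =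
  -- 0` would give them modulus one.
  set θ : ℂ → n → ℂ := fun ξ i =>
    if 0 < z i then Complex.exp ((((-p : ℝ) : ℂ) * ξ + (p : ℝ)) * Real.log (z i)) else 0 with hθ
  set γ : ℂ → ι → ℂ := fun ξ j => Complex.exp (((p : ℂ) * ξ + (0 : ℝ)) * Real.log (c j)) with hγ
  set f : ℂ → ℂ := fun ξ => ∑ i, ∑ j, θ ξ i * γ ξ j *
    Q (((p / 2 : ℝ) : ℂ) * ξ + ((-1 / 2 : ℝ) : ℂ)) j i i with hf
  have hfb : EntireStripBounded f := by
    refine .sum fun i _ => .sum fun j _ => .mul (.mul ?_ (.exp _ _ _)) ?_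
    · by_cases h : 0 < z i
      · simpa only [hθ, if_pos h] using EntireStripBounded.exp (-p) p (Real.log (z i))
      · simpa only [hθ, if_neg h] using EntireStripBounded.const 0
    · refine EntireStripBounded.matrix_mul
        (A := fun ξ => Vᴴ * diagCpow U b (((p / 2 : ℝ) : ℂ) * ξ + ((-1 / 2 : ℝ) : ℂ)) * X j)
        (B := fun ξ => diagCpow U b (((p / 2 : ℝ) : ℂ) * ξ + ((-1 / 2 : ℝ) : ℂ)) * V) ?_ ?_ i i
      · refine EntireStripBounded.matrix_mul (B := fun _ => X j) ?_ fun _ _ => .const _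
        exact EntireStripBounded.matrix_mul (A := fun _ => Vᴴ) (fun _ _ => .const _)
          (EntireStripBounded.diagCpow U b _ _)
      · exact EntireStripBounded.matrix_mul (B := fun _ => V)
          (EntireStripBounded.diagCpow U b _ _) (fun _ _ => .const _)
  -- Both edges are treated at once; the last branch, off the edges, is a trivial filler.
  have hθn : ∀ ξ : ℂ, ∀ i, ‖θ ξ i‖ ≤
      if ξ.re = 0 then z i ^ p else if ξ.re = 1 then 1 else ‖θ ξ i‖ := by
    intro ξ i
    by_cases h : 0 < z i
    · simp only [hθ, if_pos h, Complex.norm_exp]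
      split_ifs with h0 h1
      · rw [Real.rpow_def_of_pos h]
        simp [h0, mul_comm]
      · simp [h1]
      · rfl
    · simp only [hθ, if_neg h, norm_zero]
      split_ifs
      · exact Real.rpow_nonneg (hz i) p
      · exact zero_le_one
      · rfl
  have hγn : ∀ ξ : ℂ, ∀ j, ‖γ ξ j‖ = c j ^ (p * ξ.re) := by
    intro ξ j
    rw [Real.rpow_def_of_pos (hc j), Complex.norm_exp]
    simp [mul_comm]
  have hdiag : ∀ (M : Matrix n n ℂ) (i : n), M.PosSemidef → 0 ≤ (M i i).re := fun M i hM =>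
    (Complex.le_def.1 (hM.diag_nonneg (i := i))).1
  -- the left edge of the strip
  have hleft0 : ∀ w : ℂ, w.re = -1 / 2 → ∀ i,
      ∑ j, (((diagCpow U b w * V)ᴴ * X j * (diagCpow U b w * V)) i i).re ≤ 1 := by
    intro w hw i
    -- On this edge w + star w = -1, so congruence by B^w V turns B into the identity and B - ∑ X_j
    -- ≥ 0 into the claimed bound on diagonal entries.
    have h1 : ((diagCpow U b w * V)ᴴ * (diagCpow U b 1) * (diagCpow U b w * V)) = 1 := by
      rw [Matrix.conjTranspose_mul, diagCpow_conjTranspose]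
      calc Vᴴ * diagCpow U b (star w) * diagCpow U b 1 * (diagCpow U b w * V)
          = Vᴴ * ((diagCpow U b (star w) * diagCpow U b 1) * diagCpow U b w) * V := by
            simp only [Matrix.mul_assoc]
        _ = 1 := by
            rw [diagCpow_mul hU, diagCpow_mul hU,
              show star w + 1 + w = 0 from Complex.ext (by simp [hw]; norm_num) (by simp),
              diagCpow_zero hU', Matrix.mul_one, hV]
    have h2 := hdiag _ i (hle.conjTranspose_mul_mul_same (diagCpow U b w * V))
    have h3 : diagCpow U b 1 = U * Matrix.diagonal (fun k => (b k : ℂ)) * Uᴴ := by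
      simpa using diagCpow_ofReal U hb 1
    rw [← h3, Matrix.mul_sub, Matrix.sub_mul, h1, Matrix.mul_sum, Matrix.sum_mul] at h2
    simpa [Matrix.sum_apply] using h2
  have hleft : ∀ ξ : ℂ, ξ.re = 0 → ‖f ξ‖ ≤ ∑ i, z i ^ p := by
    intro ξ hξ
    refine (norm_sum_le _ _).trans (Finset.sum_le_sum fun i _ => ?_)
    refine (norm_sum_le _ _).trans ?_
    set w : ℂ := ((p / 2 : ℝ) : ℂ) * ξ + ((-1 / 2 : ℝ) : ℂ) with hw
    have hwr : w.re = -1 / 2 := by simp [hw, hξ]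
    have h1 := hleft0 w hwr i
    have h2 := hleft0 (star w) (by simpa using hwr) i
    have hθi := hθn ξ i
    rw [if_pos hξ] at hθi
    calc ∑ j, ‖θ ξ i * γ ξ j * Q w j i i‖
        ≤ ∑ j, z i ^ p *
          ((((diagCpow U b (star w) * V)ᴴ * X j * (diagCpow U b (star w) * V)) i i).re / 2 +
          (((diagCpow U b w * V)ᴴ * X j * (diagCpow U b w * V)) i i).re / 2) := by
          refine Finset.sum_le_sum fun j _ => ?_
          rw [norm_mul, norm_mul, hγn, hξ, mul_zero, Real.rpow_zero, mul_one, hQ']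
          exact mul_le_mul hθi (norm_diag_le_of_posSemidef (hX j) _ _ i) (norm_nonneg _)
            (Real.rpow_nonneg (hz i) p)
      _ ≤ z i ^ p := by
          rw [← Finset.mul_sum, Finset.sum_add_distrib, ← Finset.sum_div, ← Finset.sum_div]
          exact mul_le_of_le_one_right (Real.rpow_nonneg (hz i) p) (by linarith)
  -- the right edge of the strip
  have hright0 : ∀ w : ℂ, w.re = (p - 1) / 2 → ∀ j,
      ∑ i, (((diagCpow U b w * V)ᴴ * X j * (diagCpow U b w * V)) i i).re =
        ((diagCpow U b ((p - 1 : ℝ) : ℂ) * X j).trace).re := by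
    intro w hw j
    rw [← Complex.re_sum]
    change (((diagCpow U b w * V)ᴴ * X j * (diagCpow U b w * V)).trace).re = _
    -- Summing over i produces a full trace, in which V cancels and only w + star w = p - 1
    -- survives.
    rw [Matrix.mul_assoc, Matrix.trace_mul_comm, Matrix.conjTranspose_mul, diagCpow_conjTranspose,
      Matrix.mul_assoc (X j)]
    rw [show diagCpow U b w * V * (Vᴴ * diagCpow U b (star w)) =
        diagCpow U b w * (V * Vᴴ) * diagCpow U b (star w) by simp only [Matrix.mul_assoc], hV',
      Matrix.mul_one, diagCpow_mul hU, Matrix.trace_mul_comm]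
    congr 4
    exact Complex.ext (by simp [hw]) (by simp)
  have hright : ∀ ξ : ℂ, ξ.re = 1 → ‖f ξ‖ ≤
      ∑ j, c j ^ p * ((diagCpow U b ((p - 1 : ℝ) : ℂ) * X j).trace).re := by
    intro ξ hξ
    set w : ℂ := ((p / 2 : ℝ) : ℂ) * ξ + ((-1 / 2 : ℝ) : ℂ) with hw
    have hwr : w.re = (p - 1) / 2 := by simp [hw, hξ]; ring
    refine (norm_sum_le _ _).trans ?_
    refine (Finset.sum_le_sum fun i _ => norm_sum_le _ _).trans ?_
    rw [Finset.sum_comm]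
    refine Finset.sum_le_sum fun j _ => ?_
    have h1 := hright0 w hwr j
    have h2 := hright0 (star w) (by simpa using hwr) j
    calc ∑ i, ‖θ ξ i * γ ξ j * Q w j i i‖
        ≤ ∑ i, c j ^ p *
          ((((diagCpow U b (star w) * V)ᴴ * X j * (diagCpow U b (star w) * V)) i i).re / 2 +
          (((diagCpow U b w * V)ᴴ * X j * (diagCpow U b w * V)) i i).re / 2) := by
          refine Finset.sum_le_sum fun i _ => ?_
          have hθi := hθn ξ i
          rw [if_neg (by simp [hξ]), if_pos hξ] at hθi
          rw [norm_mul, norm_mul, hγn, hξ, mul_one, hQ']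
          refine mul_le_mul ?_ (norm_diag_le_of_posSemidef (hX j) _ _ i) (norm_nonneg _)
            (Real.rpow_nonneg (hc j).le p)
          exact mul_le_of_le_one_left (Real.rpow_nonneg (hc j).le p) hθi
      _ = _ := by
          rw [← Finset.mul_sum, Finset.sum_add_distrib, ← Finset.sum_div, ← Finset.sum_div, h1, h2]
          ring
  -- the value at `1 / p`
  have hmid : f ((1 / p : ℝ) : ℂ) = ((∑ i, z i ^ p : ℝ) : ℂ) := by
    have hw : ((p / 2 : ℝ) : ℂ) * ((1 / p : ℝ) : ℂ) + ((-1 / 2 : ℝ) : ℂ) = 0 := by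
      rw [← Complex.ofReal_mul, ← Complex.ofReal_add, ← Complex.ofReal_zero]
      congr 1
      field_simp
      norm_num
    have hγ1 : ∀ j, γ ((1 / p : ℝ) : ℂ) j = c j := by
      intro j
      have : ((p : ℂ) * ((1 / p : ℝ) : ℂ) + (0 : ℝ)) = 1 := by
        rw [← Complex.ofReal_mul, mul_one_div_cancel hp0.ne']
        simp
      simp only [hγ]
      rw [this, one_mul, ← Complex.ofReal_exp, Real.exp_log (hc j)]
    simp only [hf, hw, hγ1]
    rw [Complex.ofReal_sum]
    refine Finset.sum_congr rfl fun i _ => ?_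
    have hsum : ∑ j, (c j : ℂ) * Q 0 j i i = z i := by
      have : ∑ j, (c j : ℂ) • Q 0 j = Matrix.diagonal fun i => (z i : ℂ) := by
        simp only [hQ, diagCpow_zero hU', Matrix.mul_one, Matrix.one_mul]
        calc ∑ j, (c j : ℂ) • (Vᴴ * X j * V) = Vᴴ * (∑ j, (c j : ℂ) • X j) * V := by
              rw [Matrix.mul_sum, Matrix.sum_mul]
              simp
          _ = (Vᴴ * V) * Matrix.diagonal (fun i => (z i : ℂ)) * (Vᴴ * V) := by
              rw [hZ]; simp only [Matrix.mul_assoc]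
          _ = _ := by rw [hV]; simp
      simpa [Matrix.sum_apply] using congrFun (congrFun this i) i
    simp only [mul_assoc]
    rw [← Finset.mul_sum, hsum]
    by_cases h : 0 < z i
    · have : (((-p : ℝ) : ℂ) * ((1 / p : ℝ) : ℂ) + (p : ℝ)) = ((p - 1 : ℝ) : ℂ) := by
        rw [← Complex.ofReal_mul, ← Complex.ofReal_add]
        congr 1
        field_simp
        ring
      simp only [hθ, if_pos h]
      rw [this, ← Complex.ofReal_mul, ← Complex.ofReal_exp, ← Complex.ofReal_mul]
      congr 1
      rw [mul_comm (p - 1), ← Real.rpow_def_of_pos h]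
      nth_rewrite 2 [← Real.rpow_one (z i)]
      rw [← Real.rpow_add h]
      congr 1
      ring
    · have : z i = 0 := le_antisymm (not_lt.1 h) (hz i)
      simp [this, hp0.ne']
  have h3 := hfb.norm_le hleft hright (s := 1 / p) (by positivity)
    (by rw [div_le_one hp0]; exact hp.le)
  have hF : 0 ≤ ∑ i, z i ^ p := Finset.sum_nonneg fun i _ => Real.rpow_nonneg (hz i) p
  rw [hmid, Complex.norm_real, Real.norm_of_nonneg hF] at h3
  have hR : 0 ≤ ∑ j, c j ^ p * ((diagCpow U b ((p - 1 : ℝ) : ℂ) * X j).trace).re :=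
    (norm_nonneg _).trans (hright 1 (by simp))
  rcases hF.eq_or_lt with h0 | h0
  · rwa [← h0]
  -- The quantity F to be bounded is also the left-edge bound: F ≤ F^{1-1/p} R^{1/p}, so a power of
  -- F > 0 can be divided out.
  · have h4 : (∑ i, z i ^ p) = (∑ i, z i ^ p) ^ (1 - 1 / p) * (∑ i, z i ^ p) ^ (1 / p) := by
      rw [← Real.rpow_add h0]
      simp
    have h5 := le_of_mul_le_mul_left (h4.symm.le.trans h3) (Real.rpow_pos_of_pos h0 _)
    exact (Real.rpow_le_rpow_iff hF hR (by positivity)).1 h5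

/-! ### Traces of functions of matrices -/

theorem cfc_eq_mul_diagonal_mul {A : Matrix n n ℂ} (hA : A.IsHermitian) (f : ℝ → ℝ) :
    cfc f A = (hA.eigenvectorUnitary : Matrix n n ℂ) *
      Matrix.diagonal (fun i => (f (hA.eigenvalues i) : ℂ)) *
        (hA.eigenvectorUnitary : Matrix n n ℂ)ᴴ := by
  rw [hA.cfc_eq, Matrix.IsHermitian.cfc, Unitary.conjStarAlgAut_apply]
  rfl

theorem eigenvectorUnitary_mul_conjTranspose {A : Matrix n n ℂ} (hA : A.IsHermitian) :
    (hA.eigenvectorUnitary : Matrix n n ℂ) * (hA.eigenvectorUnitary : Matrix n n ℂ)ᴴ = 1 :=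
  Unitary.coe_mul_star_self hA.eigenvectorUnitary

theorem conjTranspose_mul_eigenvectorUnitary {A : Matrix n n ℂ} (hA : A.IsHermitian) :
    (hA.eigenvectorUnitary : Matrix n n ℂ)ᴴ * (hA.eigenvectorUnitary : Matrix n n ℂ) = 1 :=
  Unitary.coe_star_mul_self hA.eigenvectorUnitary

theorem eq_mul_diagonal_mul {A : Matrix n n ℂ} (hA : A.IsHermitian) :
    A = (hA.eigenvectorUnitary : Matrix n n ℂ) *
      Matrix.diagonal (fun i => (hA.eigenvalues i : ℂ)) *
        (hA.eigenvectorUnitary : Matrix n n ℂ)ᴴ := by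
  conv_lhs => rw [← cfc_id ℝ A hA.isSelfAdjoint]
  rw [cfc_eq_mul_diagonal_mul hA]
  rfl

theorem trace_cfc {A : Matrix n n ℂ} (hA : A.IsHermitian) (f : ℝ → ℝ) :
    (cfc f A).trace = ∑ i, (f (hA.eigenvalues i) : ℂ) := by
  rw [cfc_eq_mul_diagonal_mul hA, Matrix.trace_mul_comm, ← Matrix.mul_assoc,
    conjTranspose_mul_eigenvectorUnitary, Matrix.one_mul, Matrix.trace_diagonal]

theorem trace_mpow_re {A : Matrix n n ℂ} (hA : A.IsHermitian) (p : ℝ) :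
    (mpow A p).trace.re = ∑ i, hA.eigenvalues i ^ p := by
  rw [mpow, trace_cfc hA, ← Complex.ofReal_sum, Complex.ofReal_re]

/-- The spectrum is finite, so the functional calculus applies to logarithms, negative powers and
indicator functions alike. -/
theorem continuousOn_spectrum (A : Matrix n n ℂ) (f : ℝ → ℝ) : ContinuousOn f (spectrum ℝ A) :=
  A.finite_real_spectrum.continuousOn f

theorem isHermitian_cfc (A : Matrix n n ℂ) (f : ℝ → ℝ) : (cfc f A).IsHermitian :=
  (cfc_predicate f A : IsSelfAdjoint _)

theorem posSemidef_cfc (A : Matrix n n ℂ) {f : ℝ → ℝ} (hf : ∀ x ∈ spectrum ℝ A, 0 ≤ f x) :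
    (cfc f A).PosSemidef := by
  open scoped MatrixOrder in
  exact Matrix.nonneg_iff_posSemidef.1 (cfc_nonneg hf)

theorem nonneg_of_mem_spectrum {A : Matrix n n ℂ} (hA : A.PosSemidef) {x : ℝ}
    (hx : x ∈ spectrum ℝ A) : 0 ≤ x := by
  rw [hA.1.spectrum_real_eq_range_eigenvalues] at hx
  obtain ⟨i, rfl⟩ := hx
  exact hA.eigenvalues_nonneg i

theorem posSemidef_mpow {A : Matrix n n ℂ} (hA : A.PosSemidef) (s : ℝ) : (mpow A s).PosSemidef :=
  posSemidef_cfc A fun _ hx => Real.rpow_nonneg (nonneg_of_mem_spectrum hA hx) s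

theorem mpow_mul_self {A : Matrix n n ℂ} (hA : A.PosSemidef) {s : ℝ} (hs : 0 < s) :
    mpow A s * A = mpow A (s + 1) := by
  rw [mpow]
  nth_rewrite 2 [← cfc_id ℝ A hA.1.isSelfAdjoint]
  rw [← cfc_mul _ _ A (continuousOn_spectrum _ _) (continuousOn_spectrum _ _)]
  refine cfc_congr fun x hx => ?_
  rcases (nonneg_of_mem_spectrum hA hx).eq_or_lt with h | h
  · rw [← h]
    simp [(by linarith : s + 1 ≠ 0)]
  · simp [Real.rpow_add h]

theorem trace_mul_re_nonneg {A B : Matrix n n ℂ} (hA : A.PosSemidef) (hB : B.PosSemidef) :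
    0 ≤ (A * B).trace.re := by
  obtain ⟨Y, rfl⟩ : ∃ Y : Matrix n n ℂ, B = Yᴴ * Y := by
    open scoped MatrixOrder in
    exact CStarAlgebra.nonneg_iff_eq_star_mul_self.1 (Matrix.nonneg_iff_posSemidef.2 hB)
  rw [← Matrix.mul_assoc, Matrix.trace_mul_comm, ← Matrix.mul_assoc]
  exact (Complex.le_def.1 (hA.mul_mul_conjTranspose_same Y).trace_nonneg).1

/-- The joint spectral distribution of a pair of Hermitian matrices. -/
theorem exists_trace_cfc_mul_cfc {A B : Matrix n n ℂ} (hA : A.IsHermitian) (hB : B.IsHermitian) :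
    ∃ w : n → n → ℝ, (∀ k i, 0 ≤ w k i) ∧ ∀ f g : ℝ → ℝ, (cfc f A * cfc g B).trace.re =
      ∑ k, ∑ i, w k i * (f (hA.eigenvalues k) * g (hB.eigenvalues i)) := by
  set U : Matrix n n ℂ := (hA.eigenvectorUnitary : Matrix n n ℂ)
  set V : Matrix n n ℂ := (hB.eigenvectorUnitary : Matrix n n ℂ)
  -- The weights are the squared overlaps of the eigenvectors of `A` and `B`.
  refine ⟨fun k i => Complex.normSq ((Uᴴ * V) k i), fun k i => Complex.normSq_nonneg _,
    fun f g => ?_⟩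
  rw [cfc_eq_mul_diagonal_mul hA, cfc_eq_mul_diagonal_mul hB]
  have : ∀ D D' : Matrix n n ℂ, (U * D * Uᴴ * (V * D' * Vᴴ)).trace =
      (D * (Uᴴ * V) * (D' * (Uᴴ * V)ᴴ)).trace := by
    intro D D'
    rw [show U * D * Uᴴ * (V * D' * Vᴴ) = U * (D * Uᴴ * (V * D' * Vᴴ)) by
      simp only [Matrix.mul_assoc], Matrix.trace_mul_comm]
    rw [Matrix.conjTranspose_mul, Matrix.conjTranspose_conjTranspose]
    simp only [Matrix.mul_assoc]
  rw [this, Matrix.trace, Complex.re_sum]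
  refine Finset.sum_congr rfl fun k _ => ?_
  rw [Matrix.diag_apply, Matrix.mul_apply, Complex.re_sum]
  refine Finset.sum_congr rfl fun i _ => ?_
  rw [Matrix.diagonal_mul, Matrix.diagonal_mul, Matrix.conjTranspose_apply]
  rw [show ∀ a b c d : ℂ, a * b * (c * d) = (a * c) * (b * d) by intros; ring, Complex.star_def,
    Complex.mul_conj, ← Complex.ofReal_mul, ← Complex.ofReal_mul, Complex.ofReal_re, mul_comm]

/-- Young's inequality under the trace. -/
theorem trace_mul_mpow_le {A B : Matrix n n ℂ} (hA : A.PosSemidef) (hB : B.PosSemidef) {p : ℝ}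
    (hp : 1 < p) : p * (A * mpow B (p - 1)).trace.re ≤
      (mpow A p).trace.re + (p - 1) * (mpow B p).trace.re := by
  obtain ⟨w, hw, h⟩ := exists_trace_cfc_mul_cfc hA.1 hB.1
  -- The same weights serve all three traces, a constant function giving each marginal. What remains
  -- is the scalar inequality p a b^{p-1} ≤ a^p + (p-1) b^p for each pair of eigenvalues.
  have h1 := h id (fun x => x ^ (p - 1))
  have h2 := h (fun x => x ^ p) (fun _ => 1)
  have h3 := h (fun _ => 1) (fun x => x ^ p)
  rw [cfc_id ℝ A hA.1.isSelfAdjoint] at h1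
  rw [cfc_const_one ℝ B hB.1.isSelfAdjoint, mul_one] at h2
  rw [cfc_const_one ℝ A hA.1.isSelfAdjoint, one_mul] at h3
  rw [mpow, mpow, mpow, h1, h2, h3]
  simp only [Finset.mul_sum, ← Finset.sum_add_distrib]
  refine Finset.sum_le_sum fun k _ => Finset.sum_le_sum fun i _ => ?_
  have ha := hA.eigenvalues_nonneg k
  have hb := hB.eigenvalues_nonneg i
  set a := hA.1.eigenvalues k
  set b := hB.1.eigenvalues i
  have hq : p.HolderConjugate (p / (p - 1)) := Real.HolderConjugate.conjExponent hp
  have hY := Real.young_inequality_of_nonneg ha (Real.rpow_nonneg hb (p - 1)) hq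
  rw [← Real.rpow_mul hb, mul_div_cancel₀ _ (by linarith : p - 1 ≠ 0), div_div_eq_mul_div] at hY
  have hp0 : 0 < p := by linarith
  have hY' : p * (a * b ^ (p - 1)) ≤ a ^ p + (p - 1) * b ^ p := by
    have := mul_le_mul_of_nonneg_left hY hp0.le
    rw [mul_add, mul_div_cancel₀ _ hp0.ne', mul_div_cancel₀ _ hp0.ne'] at this
    linarith
  have := mul_le_mul_of_nonneg_left hY' (hw k i)
  simp only [id]
  linarith

theorem trace_mul_mpow_self {A : Matrix n n ℂ} (hA : A.PosSemidef) {p : ℝ} (hp : 1 < p) :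
    A * mpow A (p - 1) = mpow A p := by
  have h := mpow_mul_self hA (s := p - 1) (by linarith)
  rw [sub_add_cancel] at h
  rw [← h]
  exact ((Commute.refl A).cfc_real _).eq.symm

/-- The power function need not be operator monotone, but the trace is: combine Young's inequality
for (B, A) with Tr (B A^{p-1}) ≥ Tr A^p. -/
theorem trace_mpow_mono {A B : Matrix n n ℂ} (hA : A.PosSemidef) (hAB : (B - A).PosSemidef)
    {p : ℝ} (hp : 1 < p) : (mpow A p).trace.re ≤ (mpow B p).trace.re := by
  have hB : B.PosSemidef := by simpa using hA.add hAB
  have h1 := trace_mul_mpow_le hB hA hp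
  have h2 := trace_mul_re_nonneg hAB (posSemidef_mpow hA (p - 1))
  rw [Matrix.sub_mul, Matrix.trace_sub, Complex.sub_re, trace_mul_mpow_self hA hp] at h2
  have h3 := mul_nonneg (by linarith : 0 ≤ p) h2
  linarith

theorem trace_mpow_nonneg {A : Matrix n n ℂ} (hA : A.PosSemidef) (p : ℝ) :
    0 ≤ (mpow A p).trace.re :=
  (Complex.le_def.1 (posSemidef_mpow hA p).trace_nonneg).1

/-- A discrete Araki-Lieb-Thirring type inequality. -/
theorem trace_mpow_sum_le {ι : Type*} [Fintype ι] {B : Matrix n n ℂ} (hB : B.PosDef)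
    {X : ι → Matrix n n ℂ} (hX : ∀ j, (X j).PosSemidef) (hle : (B - ∑ j, X j).PosSemidef)
    {c : ι → ℝ} (hc : ∀ j, 0 < c j) {p : ℝ} (hp : 1 < p) :
    (mpow (∑ j, (c j : ℂ) • X j) p).trace.re ≤
      ∑ j, c j ^ p * (mpow B (p - 1) * X j).trace.re := by
  have hZ : (∑ j, (c j : ℂ) • X j).PosSemidef :=
    Matrix.posSemidef_sum _ fun j _ => (hX j).smul (by exact_mod_cast (hc j).le)
  rw [trace_mpow_re hZ.1]
  have h := sum_rpow_le_of_sum_le_diagonal (conjTranspose_mul_eigenvectorUnitary hB.1)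
    (eigenvectorUnitary_mul_conjTranspose hB.1) (conjTranspose_mul_eigenvectorUnitary hZ.1)
    (eigenvectorUnitary_mul_conjTranspose hZ.1) hB.eigenvalues_pos hZ.eigenvalues_nonneg hX hc
    (by rwa [← eq_mul_diagonal_mul]) (eq_mul_diagonal_mul hZ.1) hp
  rwa [diagCpow_ofReal _ hB.eigenvalues_pos, ← cfc_eq_mul_diagonal_mul hB.1 (fun x => x ^ (p - 1))]
    at h

/-- Each eigenvalue is shifted by δ. This removes the regularisation that makes E X positive
definite. -/
theorem tendsto_trace_mpow_add {A : Matrix n n ℂ} (hA : A.PosSemidef) {p : ℝ} (hp : 1 < p) :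
    Tendsto (fun δ : ℝ => (mpow (A + (δ : ℂ) • 1) p).trace.re) (𝓝 0) (𝓝 (mpow A p).trace.re) := by
  have h : ∀ δ : ℝ, (mpow (A + (δ : ℂ) • 1) p).trace.re =
      ∑ i, (hA.1.eigenvalues i + δ) ^ p := by
    intro δ
    have : A + (δ : ℂ) • 1 = cfc (fun x : ℝ => x + δ) A := by
      rw [cfc_add_const δ (fun x => x) A (continuousOn_spectrum _ _) hA.1.isSelfAdjoint,
        cfc_id' ℝ A hA.1.isSelfAdjoint, Algebra.algebraMap_eq_smul_one]
      rfl
    rw [this, mpow, ← cfc_comp' (fun x : ℝ => x ^ p) (fun x => x + δ) A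
      ((A.finite_real_spectrum.image _).continuousOn _) (continuousOn_spectrum _ _)
      hA.1.isSelfAdjoint, trace_cfc hA.1, ← Complex.ofReal_sum, Complex.ofReal_re]
  simp only [h]
  rw [trace_mpow_re hA.1]
  refine tendsto_finsetSum _ fun i _ => ?_
  have : ContinuousAt (fun δ : ℝ => (hA.1.eigenvalues i + δ) ^ p) 0 :=
    ContinuousAt.rpow_const (by fun_prop) (Or.inr (by linarith))
  simpa using this.tendsto

/-! ### Conjugation by a projective representation -/

namespace ProjectiveRep

/-- The conjugation `x ↦ u(g)^* x u(g)`. -/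
def act (U : ProjectiveRep G n) (g : G) : Matrix n n ℂ →ₗ[ℂ] Matrix n n ℂ where
  toFun x := (U.u g)ᴴ * x * U.u g
  map_add' x y := by rw [Matrix.mul_add, Matrix.add_mul]
  map_smul' c x := by simp

variable (U : ProjectiveRep G n)

theorem act_apply (g : G) (x : Matrix n n ℂ) : U.act g x = (U.u g)ᴴ * x * U.u g := rfl

theorem mul_conjTranspose (g : G) : U.u g * (U.u g)ᴴ = 1 :=
  Matrix.mem_unitaryGroup_iff.1 (U.unitary g)

theorem conjTranspose_mul (g : G) : (U.u g)ᴴ * U.u g = 1 :=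
  Matrix.mem_unitaryGroup_iff'.1 (U.unitary g)

theorem continuous_act (x : Matrix n n ℂ) : Continuous fun g => U.act g x := U.continuous x

/-- The projective phase cancels against its conjugate, so conjugation is a genuine right action. -/
theorem act_mul (g h : G) (x : Matrix n n ℂ) : U.act (g * h) x = U.act h (U.act g x) := by
  obtain ⟨c, hc, hu⟩ := U.mul g h
  have hcc : c * star c = 1 := by
    rw [Complex.star_def, Complex.mul_conj, Complex.normSq_eq_norm_sq, hc]
    simp
  simp only [act_apply]
  rw [hu, Matrix.conjTranspose_smul, Matrix.conjTranspose_mul]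
  simp only [Matrix.smul_mul, Matrix.mul_smul, smul_smul, hcc, one_smul, Matrix.mul_assoc]

/-- `u 1` need not be the identity; but conjugation by it is idempotent and invertible, hence
trivial. -/
theorem act_one (x : Matrix n n ℂ) : U.act 1 x = x := by
  have h : U.act 1 (U.act 1 x) = U.act 1 x := by rw [← act_mul, mul_one]
  have h2 : ∀ y, U.u 1 * U.act 1 y * (U.u 1)ᴴ = y := by
    intro y
    rw [act_apply]
    calc U.u 1 * ((U.u 1)ᴴ * y * U.u 1) * (U.u 1)ᴴ
        = (U.u 1 * (U.u 1)ᴴ) * y * (U.u 1 * (U.u 1)ᴴ) := by simp only [Matrix.mul_assoc]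
      _ = y := by rw [U.mul_conjTranspose]; simp
  rw [← h2 (U.act 1 x), h, h2 x]

theorem act_mul_act (g : G) (x y : Matrix n n ℂ) : U.act g x * U.act g y = U.act g (x * y) := by
  simp only [act_apply]
  calc (U.u g)ᴴ * x * U.u g * ((U.u g)ᴴ * y * U.u g)
      = (U.u g)ᴴ * x * (U.u g * (U.u g)ᴴ) * y * U.u g := by simp only [Matrix.mul_assoc]
    _ = (U.u g)ᴴ * (x * y) * U.u g := by
      rw [U.mul_conjTranspose]; simp only [Matrix.mul_assoc, Matrix.mul_one]

theorem act_conjTranspose (g : G) (x : Matrix n n ℂ) : (U.act g x)ᴴ = U.act g xᴴ := by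
  simp [act_apply, Matrix.mul_assoc]

theorem act_one_right (g : G) : U.act g 1 = 1 := by
  simp [act_apply, U.conjTranspose_mul]

theorem trace_act (g : G) (x : Matrix n n ℂ) : (U.act g x).trace = x.trace := by
  rw [act_apply, Matrix.trace_mul_comm, ← Matrix.mul_assoc, U.mul_conjTranspose, Matrix.one_mul]

theorem posSemidef_act (g : G) {x : Matrix n n ℂ} (hx : x.PosSemidef) :
    (U.act g x).PosSemidef := hx.conjTranspose_mul_mul_same _

/-- Invariance is rephrased as commutation because commutation is inherited by functional calculus;
this is what makes functions of σ invariant. -/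
theorem act_eq_self_iff (g : G) (x : Matrix n n ℂ) : U.act g x = x ↔ Commute x (U.u g) := by
  rw [act_apply]
  constructor
  · intro h
    have : U.u g * ((U.u g)ᴴ * x * U.u g) = U.u g * x := by rw [h]
    rwa [← Matrix.mul_assoc, ← Matrix.mul_assoc, U.mul_conjTranspose, Matrix.one_mul] at this
  · intro h
    rw [Matrix.mul_assoc, h.eq, ← Matrix.mul_assoc, U.conjTranspose_mul, Matrix.one_mul]

theorem act_cfc {g : G} {x : Matrix n n ℂ} (h : U.act g x = x) (f : ℝ → ℝ) :
    U.act g (cfc f x) = cfc f x :=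
  (U.act_eq_self_iff g _).2 (((U.act_eq_self_iff g x).1 h).cfc_real f)

end ProjectiveRep

/-! ### Averages of the conjugation -/

section average

variable [IsTopologicalGroup G] [CompactSpace G] [SecondCountableTopology G] [BorelSpace G]
variable {μ : Measure G} [μ.IsHaarMeasure] [IsProbabilityMeasure μ]

/-- Compact groups are unimodular: a right translate of μ is again a Haar probability measure, so
uniqueness applies. -/
theorem isMulRightInvariant_of_compact : μ.IsMulRightInvariant := by
  refine ⟨fun g => ?_⟩
  have : IsProbabilityMeasure (μ.map (· * g)) :=
    Measure.isProbabilityMeasure_map (measurable_mul_const g).aemeasurable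
  exact Measure.isHaarMeasure_eq_of_isProbabilityMeasure _ μ

theorem isInvInvariant_of_compact : μ.IsInvInvariant := by
  have : μ.IsMulRightInvariant := isMulRightInvariant_of_compact
  have : IsProbabilityMeasure μ.inv := Measure.isProbabilityMeasure_map measurable_inv.aemeasurable
  have : μ.inv.IsHaarMeasure :=
    Measure.isHaarMeasure_of_isCompact_nonempty_interior _ Set.univ isCompact_univ (by simp)
      (by simp) (by simp)
  exact ⟨Measure.isHaarMeasure_eq_of_isProbabilityMeasure _ μ⟩

/-- The average `∫ φ(g) u(g)^* x u(g) dμ(g)`. -/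
def actAverage (μ : Measure G) (U : ProjectiveRep G n) (φ : G → ℝ) (x : Matrix n n ℂ) :
    Matrix n n ℂ := ∫ g, (φ g : ℂ) • U.act g x ∂μ

variable (U : ProjectiveRep G n)

theorem integrable_smul_act {φ : G → ℝ} (hφ : Integrable φ μ) (x : Matrix n n ℂ) :
    Integrable (fun g => (φ g : ℂ) • U.act g x) μ := by
  obtain ⟨C, hC⟩ := isCompact_univ.exists_bound_of_continuousOn (U.continuous_act x).continuousOn
  exact (hφ.ofReal (𝕜 := ℂ)).smul_bdd C (U.continuous_act x).aestronglyMeasurable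
    (Eventually.of_forall fun g => hC g (Set.mem_univ g))

theorem map_actAverage {E : Type*} [NormedAddCommGroup E] [NormedSpace ℂ E] [CompleteSpace E]
    (L : Matrix n n ℂ →ₗ[ℂ] E) {φ : G → ℝ} (hφ : Integrable φ μ) (x : Matrix n n ℂ) :
    L (actAverage μ U φ x) = ∫ g, (φ g : ℂ) • L (U.act g x) ∂μ := by
  have h := (LinearMap.toContinuousLinearMap L).integral_comp_comm (integrable_smul_act U hφ x)
  simp only [LinearMap.coe_toContinuousLinearMap', map_smul] at h
  exact h.symm

theorem trace_mul_actAverage {φ : G → ℝ} (hφ : Integrable φ μ) (y x : Matrix n n ℂ) :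
    (y * actAverage μ U φ x).trace = ∫ g, (φ g : ℂ) * (y * U.act g x).trace ∂μ :=
  map_actAverage U (Matrix.traceLinearMap n ℂ ℂ ∘ₗ LinearMap.mulLeft ℂ y) hφ x

theorem posSemidef_actAverage {φ : G → ℝ} (hφ : Integrable φ μ) (h0 : 0 ≤ᵐ[μ] φ)
    {x : Matrix n n ℂ} (hx : x.PosSemidef) : (actAverage μ U φ x).PosSemidef := by
  have hquad : ∀ v : n → ℂ, star v ⬝ᵥ (actAverage μ U φ x *ᵥ v) =
      ∫ g, (φ g : ℂ) • (star v ⬝ᵥ (U.act g x *ᵥ v)) ∂μ := by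
    intro v
    exact map_actAverage U
      ({ toFun := fun y => star v ⬝ᵥ (y *ᵥ v)
         map_add' := fun y z => by rw [Matrix.add_mulVec, dotProduct_add]
         map_smul' := fun c y => by
          rw [Matrix.smul_mulVec, dotProduct_smul]; rfl } : Matrix n n ℂ →ₗ[ℂ] ℂ) hφ x
  refine .of_dotProduct_mulVec_nonneg ?_ fun v => ?_
  · have h := (Matrix.conjTransposeLinearEquiv n n ℝ
      ℂ).toLinearMap.toContinuousLinearMap.integral_comp_comm
      (integrable_smul_act U hφ x)
    have h' : (actAverage μ U φ x)ᴴ = ∫ g, ((φ g : ℂ) • U.act g x)ᴴ ∂μ := h.symm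
    rw [Matrix.IsHermitian, h']
    refine integral_congr_ae (Eventually.of_forall fun g => ?_)
    simp only [Matrix.conjTranspose_smul, U.act_conjTranspose, hx.1.eq, Complex.star_def,
      Complex.conj_ofReal]
  · rw [hquad]
    refine integral_nonneg_of_ae (h0.mono fun g hg => ?_)
    exact mul_nonneg (Complex.zero_le_real.2 hg)
      ((U.posSemidef_act g hx).dotProduct_mulVec_nonneg v)

theorem actAverage_sub {φ ψ : G → ℝ} (hφ : Integrable φ μ) (hψ : Integrable ψ μ)
    (x : Matrix n n ℂ) :
    actAverage μ U (fun g => φ g - ψ g) x = actAverage μ U φ x - actAverage μ U ψ x := by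
  rw [actAverage, actAverage, actAverage,
    ← integral_sub (integrable_smul_act U hφ x) (integrable_smul_act U hψ x)]
  simp [sub_smul]

theorem actAverage_const_mul (c : ℝ) (φ : G → ℝ) (x : Matrix n n ℂ) :
    actAverage μ U (fun g => c * φ g) x = (c : ℂ) • actAverage μ U φ x := by
  rw [actAverage, actAverage, ← integral_smul]
  simp [mul_smul]

theorem posSemidef_actAverage_sub {φ ψ : G → ℝ} (hφ : Integrable φ μ) (hψ : Integrable ψ μ)
    (h : φ ≤ᵐ[μ] ψ) {x : Matrix n n ℂ} (hx : x.PosSemidef) :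
    (actAverage μ U ψ x - actAverage μ U φ x).PosSemidef := by
  rw [← actAverage_sub U hψ hφ]
  exact posSemidef_actAverage U (hψ.sub hφ) (h.mono fun g hg => sub_nonneg.2 hg) hx

/-- If `x` is fixed by `∫ κ(g) u(g)^* x u(g) dμ(g)` with a probability density `κ`, then
it is fixed by `u(g)` for almost all `g` in the support of `κ`. -/
theorem ae_act_eq_self {κ : G → ℝ} (hκ : Integrable κ μ) (h0 : ∀ g, 0 ≤ κ g)
    (h1 : ∫ g, κ g ∂μ = 1) {x : Matrix n n ℂ} (hx : actAverage μ U κ x = x) :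
    ∀ᵐ g ∂μ, κ g ≠ 0 → U.act g x = x := by
  have hnn : ∀ y : Matrix n n ℂ, 0 ≤ (yᴴ * y).trace.re := fun y =>
    (Complex.le_def.1 (Matrix.posSemidef_conjTranspose_mul_self y).trace_nonneg).1
  -- F is κ times the squared Hilbert–Schmidt distance from x to its conjugate. Conjugation is
  -- isometric, so the integral of F is 2‖x‖² - 2 Re⟨x, T x⟩ = 0, which forces F = 0 almost
  -- everywhere.
  set F : G → ℝ := fun g => κ g * ((U.act g x - x)ᴴ * (U.act g x - x)).trace.re with hF
  have hexp : ∀ g, F g = 2 * (xᴴ * x).trace.re * κ g -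
      2 * ((κ g : ℂ) * (xᴴ * U.act g x).trace).re := by
    intro g
    have e1 : ((U.act g x)ᴴ * U.act g x).trace = (xᴴ * x).trace := by
      rw [U.act_conjTranspose, U.act_mul_act, U.trace_act]
    have e2 : ((U.act g x)ᴴ * x).trace.re = (xᴴ * U.act g x).trace.re := by
      rw [← Complex.conj_re, ← Complex.star_def, ← Matrix.trace_conjTranspose,
        Matrix.conjTranspose_mul, Matrix.conjTranspose_conjTranspose]
    simp only [hF]
    rw [Matrix.conjTranspose_sub, Matrix.sub_mul, Matrix.mul_sub, Matrix.mul_sub, Matrix.trace_sub,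
      Matrix.trace_sub, Matrix.trace_sub, e1, Complex.sub_re, Complex.sub_re, Complex.sub_re, e2,
      Complex.re_ofReal_mul]
    ring
  have hi2 : Integrable (fun g => (κ g : ℂ) * (xᴴ * U.act g x).trace) μ := by
    have := (Matrix.traceLinearMap n ℂ ℂ ∘ₗ
      LinearMap.mulLeft ℂ xᴴ).toContinuousLinearMap.integrable_comp (integrable_smul_act U hκ x)
    simpa using this
  have hint : ∫ g, F g ∂μ = 0 := by
    simp only [hexp]
    have h2 := integral_sub (hκ.const_mul (2 * (xᴴ * x).trace.re)) (hi2.re.const_mul 2)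
    simp only [RCLike.re_eq_complex_re] at h2
    rw [h2, integral_const_mul, integral_const_mul, h1]
    have h3 := trace_mul_actAverage U hκ xᴴ x
    rw [hx] at h3
    have h4 := integral_re hi2
    simp only [RCLike.re_eq_complex_re] at h4
    rw [h4, ← h3]
    ring
  have hFi : Integrable F μ := by
    have : F = fun g => 2 * (xᴴ * x).trace.re * κ g -
      2 * ((κ g : ℂ) * (xᴴ * U.act g x).trace).re := funext hexp
    rw [this]
    exact (hκ.const_mul _).sub (hi2.re.const_mul 2)
  have hFz := (integral_eq_zero_iff_of_nonneg (fun g => mul_nonneg (h0 g) (hnn _)) hFi).1 hint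
  filter_upwards [hFz] with g hg hκg
  have h5 : ((U.act g x - x)ᴴ * (U.act g x - x)).trace.re = 0 :=
    (mul_eq_zero.1 hg).resolve_left hκg
  have h6 := (Complex.le_def.1
    (Matrix.posSemidef_conjTranspose_mul_self (U.act g x - x)).trace_nonneg).2
  exact sub_eq_zero.1 (Matrix.trace_conjTranspose_mul_self_eq_zero_iff.1
    (Complex.ext h5 h6.symm))

end average

/-! ### The fixed point algebra and its conditional expectation -/

theorem hsProj_eq_of_orthogonal (N : Submodule ℂ (Matrix n n ℂ)) {x y : Matrix n n ℂ} (hy : y ∈ N)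
    (h : ∀ z ∈ N, (zᴴ * (x - y)).trace = 0) : hsProj N x = y := by
  have hm : y - hsProj N x ∈ N := N.sub_mem hy (hsProj_mem N x)
  have h1 := h _ hm
  have h2 := hsProj_orthogonal N x _ hm
  have h3 : ((y - hsProj N x)ᴴ * (y - hsProj N x)).trace = 0 := by
    rw [show y - hsProj N x = (x - hsProj N x) - (x - y) by abel] at h1 h2 ⊢
    rw [Matrix.mul_sub, Matrix.trace_sub, h1, h2, sub_zero]
  exact (sub_eq_zero.1 (Matrix.trace_conjTranspose_mul_self_eq_zero_iff.1 h3)).symm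

section fixed

variable [IsTopologicalGroup G] [CompactSpace G] [SecondCountableTopology G] [BorelSpace G]
variable {μ : Measure G} [μ.IsHaarMeasure] [IsProbabilityMeasure μ]
variable (S : MarkovSemigroup μ) (U : ProjectiveRep G n)

/-- The group elements whose conjugation fixes `N_fix` pointwise. -/
def fixSet : Set G := {g | ∀ x ∈ Nfix S U, U.act g x = x}

theorem measurableSet_fixSet : MeasurableSet (fixSet S U) := by
  have : fixSet S U = ⋂ x ∈ Nfix S U, {g | U.act g x = x} := by
    ext g
    simp [fixSet]
  rw [this]
  exact (isClosed_biInter fun x _ =>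
    isClosed_eq (U.continuous_act x) continuous_const).measurableSet

theorem one_mem_fixSet : (1 : G) ∈ fixSet S U := fun x _ => U.act_one x

/-- This is the part of the subgroup property that is needed: the indicator of the set is invariant
under right translation by its own elements. -/
theorem mul_mem_fixSet_iff {g h : G} (hh : h ∈ fixSet S U) :
    g * h ∈ fixSet S U ↔ g ∈ fixSet S U := by
  constructor
  · intro hgh x hx
    have h1 := hgh x hx
    rw [U.act_mul] at h1
    have h2 : U.act h⁻¹ (U.act h (U.act g x)) = U.act h⁻¹ (U.act h x) := by rw [h1, hh x hx]
    rwa [← U.act_mul h h⁻¹, ← U.act_mul h h⁻¹, mul_inv_cancel, U.act_one, U.act_one] at h2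
  · intro hg x hx
    rw [U.act_mul, hg x hx, hh x hx]

theorem integral_k_inv {t : ℝ≥0} (ht : 0 < t) : ∫ g, S.k t g⁻¹ ∂μ = 1 := by
  rw [← S.mass t ht 1]
  refine integral_congr_ae (Eventually.of_forall fun h => ?_)
  have := S.right_invariant t ht 1 h h⁻¹
  simpa [MarkovSemigroup.k] using this

theorem transferred_eq_actAverage {t : ℝ≥0} (ht : 0 < t) (x : Matrix n n ℂ) :
    transferred S U t x = actAverage μ U (fun g => S.k t g⁻¹) x := by
  change transferredFun S U t x = _
  rw [transferredFun, if_neg ht.ne']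
  rfl

/-- The exceptional null set depends on the fixed point, so only a finite spanning family of N_fix
is used; linearity covers the rest. -/
theorem ae_mem_fixSet {t : ℝ≥0} (ht : 0 < t) :
    ∀ᵐ g ∂μ, S.k t g⁻¹ ≠ 0 → g ∈ fixSet S U := by
  obtain ⟨s, hs⟩ := IsNoetherian.noetherian (Nfix S U)
  have h : ∀ᵐ g ∂μ, ∀ x ∈ s, S.k t g⁻¹ ≠ 0 → U.act g x = x := by
    rw [Finset.eventually_all]
    intro x hx
    refine ae_act_eq_self U (S.integrable_k_inv ht) (fun g => S.nonneg t ht _ _)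
      (integral_k_inv S ht) ?_
    rw [← transferred_eq_actAverage S U ht]
    have : x ∈ Nfix S U := hs ▸ Submodule.subset_span hx
    exact this t
  filter_upwards [h] with g hg hk x hx
  have : Submodule.span ℂ (s : Set (Matrix n n ℂ)) ≤ LinearMap.eqLocus (U.act g) LinearMap.id :=
    Submodule.span_le.2 fun y hy => hg y hy hk
  exact this (hs ▸ hx)

/-- Probability densities concentrated on `fixSet S U`. -/
structure IsFixDensity (κ : G → ℝ) : Prop where
  measurable : Measurable κ
  nonneg : ∀ g, 0 ≤ κ g
  integrable : Integrable κ μ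
  integral_eq_one : ∫ g, κ g ∂μ = 1
  ae_mem : ∀ᵐ g ∂μ, κ g ≠ 0 → g ∈ fixSet S U

theorem isFixDensity_k_inv {t : ℝ≥0} (ht : 0 < t) : IsFixDensity S U fun g => S.k t g⁻¹ where
  measurable := ((S.measurable t ht).comp measurable_prodMk_right).comp measurable_inv
  nonneg _ := S.nonneg t ht _ _
  integrable := S.integrable_k_inv ht
  integral_eq_one := integral_k_inv S ht
  ae_mem := ae_mem_fixSet S U ht

/-- Otherwise the kernel at time 1 would vanish almost everywhere, although its integral is 1. -/
theorem measureReal_fixSet_pos : 0 < μ.real (fixSet S U) := by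
  rw [measureReal_def, ENNReal.toReal_pos_iff]
  refine ⟨pos_iff_ne_zero.2 fun h0 => ?_, measure_lt_top _ _⟩
  have h := ae_mem_fixSet S U one_pos
  have h1 : ∀ᵐ g ∂μ, g ∉ fixSet S U := measure_eq_zero_iff_ae_notMem.1 h0
  have h2 : (fun g => S.k 1 g⁻¹) =ᵐ[μ] 0 := by
    filter_upwards [h, h1] with g hg hg'
    by_contra hc
    exact hg' (hg hc)
  have h3 := integral_k_inv S one_pos
  rw [integral_congr_ae h2] at h3
  simp at h3

/-- The density of the conditional expectation onto the fixed points. -/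
def fixDensity : G → ℝ := (fixSet S U).indicator fun _ => (μ.real (fixSet S U))⁻¹

theorem isFixDensity_fixDensity : IsFixDensity S U (fixDensity S U) where
  measurable := measurable_const.indicator (measurableSet_fixSet S U)
  nonneg g := Set.indicator_nonneg (fun _ _ => inv_nonneg.2 measureReal_nonneg) g
  integrable := (integrable_const _).indicator (measurableSet_fixSet S U)
  integral_eq_one := by
    rw [fixDensity, integral_indicator_const _ (measurableSet_fixSet S U), smul_eq_mul,
      mul_inv_cancel₀ (measureReal_fixSet_pos S U).ne']
  ae_mem := Eventually.of_forall fun _ hg => Set.mem_of_indicator_ne_zero hg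

variable {S U}

namespace IsFixDensity

variable {κ : G → ℝ}

/-- The bimodule property: conjugation is multiplicative and leaves `a` and `b` unchanged wherever κ
≠ 0, up to a null set. -/
theorem average_mul_mul (hκ : IsFixDensity S U κ) {a b : Matrix n n ℂ}
    (ha : ∀ g ∈ fixSet S U, U.act g a = a)
    (hb : ∀ g ∈ fixSet S U, U.act g b = b) (x : Matrix n n ℂ) :
    actAverage μ U κ (a * x * b) = a * actAverage μ U κ x * b := by
  have h := map_actAverage U (LinearMap.mulRight ℂ b ∘ₗ LinearMap.mulLeft ℂ a) hκ.integrable x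
  simp only [LinearMap.comp_apply, LinearMap.mulLeft_apply, LinearMap.mulRight_apply] at h
  rw [h]
  refine integral_congr_ae (hκ.ae_mem.mono fun g hg => ?_)
  by_cases h0 : κ g = 0
  · simp [h0]
  · simp only [← U.act_mul_act, ha g (hg h0), hb g (hg h0)]

theorem average_of_fixed (hκ : IsFixDensity S U κ) {a : Matrix n n ℂ}
    (ha : ∀ g ∈ fixSet S U, U.act g a = a) :
    actAverage μ U κ a = a := by
  have : actAverage μ U κ a = ∫ g, κ g • a ∂μ := by
    refine integral_congr_ae (hκ.ae_mem.mono fun g hg => ?_)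
    by_cases h0 : κ g = 0
    · simp [h0]
    · simp only [ha g (hg h0)]
      rfl
  rw [this, integral_smul_const, hκ.integral_eq_one, one_smul]

theorem trace_mul_average (hκ : IsFixDensity S U κ) {a : Matrix n n ℂ}
    (ha : ∀ g ∈ fixSet S U, U.act g a = a)
    (x : Matrix n n ℂ) : (a * actAverage μ U κ x).trace = (a * x).trace := by
  rw [trace_mul_actAverage U hκ.integrable]
  have : ∫ g, (κ g : ℂ) * (a * U.act g x).trace ∂μ = ∫ g, κ g • (a * x).trace ∂μ := by
    refine integral_congr_ae (hκ.ae_mem.mono fun g hg => ?_)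
    by_cases h0 : κ g = 0
    · simp [h0]
    · simp only
      rw [← U.trace_act g (a * x), ← U.act_mul_act, ha g (hg h0)]
      rfl
  rw [this, integral_smul_const, hκ.integral_eq_one, one_smul]

theorem posSemidef_average (hκ : IsFixDensity S U κ) {x : Matrix n n ℂ} (hx : x.PosSemidef) :
    (actAverage μ U κ x).PosSemidef :=
  posSemidef_actAverage U hκ.integrable (Eventually.of_forall hκ.nonneg) hx

end IsFixDensity

variable (S U)

/-- A Galois-type duality between N_fix and its stabiliser. The nontrivial direction holds because
every T_t averages only over the stabiliser. -/
theorem mem_Nfix_iff {x : Matrix n n ℂ} : x ∈ Nfix S U ↔ ∀ g ∈ fixSet S U, U.act g x = x := by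
  refine ⟨fun hx g hg => hg x hx, fun hx t => ?_⟩
  rcases eq_or_ne t 0 with rfl | ht
  · change transferredFun S U 0 x = x
    simp [transferredFun]
  · have ht' : 0 < t := pos_iff_ne_zero.2 ht
    rw [transferred_eq_actAverage S U ht']
    exact (isFixDensity_k_inv S U ht').average_of_fixed hx

theorem act_fixDensity_average {h : G} (hh : h ∈ fixSet S U) (x : Matrix n n ℂ) :
    U.act h (actAverage μ U (fixDensity S U) x) = actAverage μ U (fixDensity S U) x := by
  have : μ.IsMulRightInvariant := isMulRightInvariant_of_compact
  rw [map_actAverage U (U.act h) (isFixDensity_fixDensity S U).integrable]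
  have h1 : ∀ g, fixDensity S U g = fixDensity S U (g * h) := by
    intro g
    by_cases hg : g ∈ fixSet S U
    · simp [fixDensity, hg, (mul_mem_fixSet_iff S U hh).2 hg]
    · simp [fixDensity, hg, mt (mul_mem_fixSet_iff S U hh).1 hg]
  simp only [← U.act_mul]
  calc ∫ g, (fixDensity S U g : ℂ) • U.act (g * h) x ∂μ
      = ∫ g, (fixDensity S U (g * h) : ℂ) • U.act (g * h) x ∂μ := by simp only [← h1]
    _ = _ := integral_mul_right_eq_self (fun g => (fixDensity S U g : ℂ) • U.act g x) h

/-- The average is invariant, by right invariance of μ, and the remainder is orthogonal to N_fix,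
since adjoints of fixed points are invariant and conjugation preserves the trace. -/
theorem Efix_eq_actAverage (x : Matrix n n ℂ) :
    Efix S U x = actAverage μ U (fixDensity S U) x := by
  refine hsProj_eq_of_orthogonal _
    ((mem_Nfix_iff S U).2 fun h hh => act_fixDensity_average S U hh x) fun z hz => ?_
  rw [Matrix.mul_sub, Matrix.trace_sub, sub_eq_zero]
  refine ((isFixDensity_fixDensity S U).trace_mul_average (fun g hg => ?_) x).symm
  rw [← U.act_conjTranspose, hg z hz]

theorem act_Efix {g : G} (hg : g ∈ fixSet S U) (x : Matrix n n ℂ) :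
    U.act g (Efix S U x) = Efix S U x := by
  rw [Efix_eq_actAverage]
  exact act_fixDensity_average S U hg x

theorem posSemidef_Efix {x : Matrix n n ℂ} (hx : x.PosSemidef) : (Efix S U x).PosSemidef := by
  rw [Efix_eq_actAverage]
  exact (isFixDensity_fixDensity S U).posSemidef_average hx

variable {S U}

/-- This is E T = E. Every lower bound below is contractivity of E applied to T X. -/
theorem IsFixDensity.Efix_average {κ : G → ℝ} (hκ : IsFixDensity S U κ) (x : Matrix n n ℂ) :
    Efix S U (actAverage μ U κ x) = Efix S U x := by
  refine hsProj_eq_of_orthogonal _ (hsProj_mem _ _) fun z hz => ?_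
  have hz' : ∀ g ∈ fixSet S U, U.act g zᴴ = zᴴ := fun g hg => by
    rw [← U.act_conjTranspose, hg z hz]
  rw [Matrix.mul_sub, Matrix.trace_sub, hκ.trace_mul_average hz', ← Matrix.trace_sub,
    ← Matrix.mul_sub]
  exact hsProj_orthogonal _ x z hz

theorem trace_mul_Efix {a : Matrix n n ℂ} (ha : ∀ g ∈ fixSet S U, U.act g a = a)
    (x : Matrix n n ℂ) : (a * Efix S U x).trace = (a * x).trace := by
  rw [Efix_eq_actAverage]
  exact (isFixDensity_fixDensity S U).trace_mul_average ha x

end fixed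

/-! ### Trace and norm inequalities for averages -/

theorem ProjectiveRep.norm_act (U : ProjectiveRep G n) (g : G) (x : Matrix n n ℂ) :
    ‖U.act g x‖ = ‖x‖ := by
  rw [U.act_apply, CStarRing.norm_mul_mem_unitary _ (U.unitary g)]
  exact CStarRing.norm_mem_unitary_mul x (Unitary.star_mem (U.unitary g))

section inequalities

variable [IsTopologicalGroup G] [CompactSpace G] [SecondCountableTopology G] [BorelSpace G]
variable {μ : Measure G} [μ.IsHaarMeasure] [IsProbabilityMeasure μ]
variable {S : MarkovSemigroup μ} {U : ProjectiveRep G n}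

theorem actAverage_sum {ι : Type*} (s : Finset ι) (U : ProjectiveRep G n) {φ : ι → G → ℝ}
    (hφ : ∀ j ∈ s, Integrable (φ j) μ) (x : Matrix n n ℂ) :
    actAverage μ U (fun g => ∑ j ∈ s, φ j g) x = ∑ j ∈ s, actAverage μ U (φ j) x := by
  simp only [actAverage, Complex.ofReal_sum, Finset.sum_smul]
  exact integral_finsetSum s fun j hj => integrable_smul_act U (hφ j hj) x

/-- Young's inequality for the pair (X, E X): since (E X)^{p-1} is invariant, the mixed term Tr (X
(E X)^{p-1}) equals Tr (E X)^p. -/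
theorem trace_mpow_Efix_le {X : Matrix n n ℂ} (hX : X.PosSemidef) {p : ℝ} (hp : 1 < p) :
    (mpow (Efix S U X) p).trace.re ≤ (mpow X p).trace.re := by
  have hB := posSemidef_Efix S U hX
  have h := trace_mul_mpow_le hX hB hp
  have h1 : (X * mpow (Efix S U X) (p - 1)).trace = (mpow (Efix S U X) p).trace := by
    have hfix : ∀ g ∈ fixSet S U,
        U.act g (mpow (Efix S U X) (p - 1)) = mpow (Efix S U X) (p - 1) :=
      fun g hg => U.act_cfc (act_Efix S U hg X) _
    rw [Matrix.trace_mul_comm, ← trace_mul_Efix hfix X, Matrix.trace_mul_comm,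
      trace_mul_mpow_self hB hp]
  rw [h1] at h
  linarith

theorem norm_Efix_le (X : Matrix n n ℂ) : ‖Efix S U X‖ ≤ ‖X‖ := by
  have he := isFixDensity_fixDensity S U
  rw [Efix_eq_actAverage, actAverage]
  refine (norm_integral_le_integral_norm _).trans (le_of_eq ?_)
  have : ∀ g, ‖(fixDensity S U g : ℂ) • U.act g X‖ = fixDensity S U g * ‖X‖ := by
    intro g
    rw [norm_smul, U.norm_act, Complex.norm_real, Real.norm_of_nonneg (he.nonneg g)]
  simp only [this]
  rw [integral_mul_const, he.integral_eq_one, one_mul]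

namespace IsFixDensity

variable {κ : G → ℝ}

/-- A probability density on the fixing set that is bounded by `M` is at most `M` times the density
of the conditional expectation. -/
theorem ae_le_mul_fixDensity (hκ : IsFixDensity S U κ) {M : ℝ} (hM : ∀ᵐ g ∂μ, κ g ≤ M) :
    ∀ᵐ g ∂μ, κ g ≤ M * fixDensity S U g := by
  filter_upwards [hM, hκ.ae_mem] with g hg hg'
  by_cases h0 : κ g = 0
  · by_cases hgf : g ∈ fixSet S U
    · rw [h0] at hg ⊢
      exact mul_nonneg hg ((isFixDensity_fixDensity S U).nonneg g)
    · simp [fixDensity, hgf, h0]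
  · rw [fixDensity, Set.indicator_of_mem (hg' h0)]
    -- The normalising factor of the density is at least 1, as μ is a probability measure.
    refine hg.trans (le_mul_of_one_le_right ((hκ.nonneg g).trans hg) ?_)
    exact (one_le_inv₀ (measureReal_fixSet_pos S U)).2 measureReal_le_one

theorem norm_average_le (hκ : IsFixDensity S U κ) {M : ℝ} (hM : ∀ᵐ g ∂μ, κ g ≤ M)
    (hM0 : 0 ≤ M) {X : Matrix n n ℂ} (hX : X.PosSemidef) :
    ‖actAverage μ U κ X‖ ≤ M * ‖Efix S U X‖ := by
  have he := isFixDensity_fixDensity S U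
  have h := posSemidef_actAverage_sub U hκ.integrable (he.integrable.const_mul M)
    (hκ.ae_le_mul_fixDensity hM) hX
  rw [actAverage_const_mul, ← Efix_eq_actAverage] at h
  have h2 : ‖actAverage μ U κ X‖ ≤ ‖(M : ℂ) • Efix S U X‖ := by
    open scoped MatrixOrder in
    exact CStarAlgebra.norm_le_norm_of_nonneg_of_le
      (Matrix.nonneg_iff_posSemidef.2 (hκ.posSemidef_average hX)) (Matrix.le_iff.2 h)
  rwa [norm_smul, Complex.norm_real, Real.norm_of_nonneg hM0] at h2

/-- κ is majorised by the simple function c ∘ f, and X is split into its averages X_j over the level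
sets of f inside the stabiliser. These add up to at most E X, and δ > 0 makes B = E X + δ positive
definite, so `trace_mpow_sum_le` applies. As B is invariant, Tr (B^{p-1} X_j) is the measure of the
level set times Tr (B^{p-1} X) = Tr (B^{p-1} E X) ≤ Tr B^p. -/
theorem trace_mpow_average_le_of_le_simple (hκ : IsFixDensity S U κ) {ι : Type*} [Fintype ι]
    [MeasurableSpace ι] [MeasurableSingletonClass ι] {f : G → ι} (hf : Measurable f) {c : ι → ℝ}
    (hc : ∀ j, 0 < c j) (hle : ∀ᵐ g ∂μ, κ g ≤ c (f g)) {X : Matrix n n ℂ} (hX : X.PosSemidef)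
    {p : ℝ} (hp : 1 < p) {δ : ℝ} (hδ : 0 < δ) :
    (mpow (actAverage μ U κ X) p).trace.re ≤
      (∫ g, c (f g) ^ p ∂μ) * (mpow (Efix S U X + (δ : ℂ) • 1) p).trace.re := by
  classical
  have he := isFixDensity_fixDensity S U
  have hE := posSemidef_Efix S U hX
  set B := Efix S U X + (δ : ℂ) • 1 with hBdef
  have hδ1 : (((δ : ℂ) • 1 : Matrix n n ℂ)).PosDef :=
    Matrix.PosDef.one.smul (Complex.zero_lt_real.2 hδ)
  have hB : B.PosDef := hδ1.posSemidef_add hE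
  set A : ι → Set G := fun j => fixSet S U ∩ f ⁻¹' {j} with hA
  have hAm : ∀ j, MeasurableSet (A j) := fun j =>
    (measurableSet_fixSet S U).inter (hf (measurableSet_singleton j))
  have hAi : ∀ j, Integrable ((A j).indicator fun _ => (1 : ℝ)) μ := fun j =>
    (integrable_const _).indicator (hAm j)
  have hsum : ∀ (a : ι → ℝ) (g : G), ∑ j, a j * (A j).indicator (fun _ => (1 : ℝ)) g =
      (fixSet S U).indicator (fun g => a (f g)) g := by
    intro a g
    by_cases hg : g ∈ fixSet S U
    · rw [Set.indicator_of_mem hg, Finset.sum_eq_single (f g)]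
      · rw [Set.indicator_of_mem (show g ∈ A (f g) from ⟨hg, rfl⟩), mul_one]
      · intro j _ hj
        rw [Set.indicator_of_notMem (fun h => hj h.2.symm), mul_zero]
      · simp
    · rw [Set.indicator_of_notMem hg]
      exact Finset.sum_eq_zero fun j _ => by
        rw [Set.indicator_of_notMem (fun h => hg h.1), mul_zero]
  have hcomb : ∀ a : ι → ℝ, ∑ j, (a j : ℂ) • actAverage μ U ((A j).indicator fun _ => (1 : ℝ)) X =
      actAverage μ U ((fixSet S U).indicator fun g => a (f g)) X := by
    intro a
    have := actAverage_sum Finset.univ U (fun j _ => (hAi j).const_mul (a j)) X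
    simp only [hsum, actAverage_const_mul] at this
    exact this.symm
  have hbdd : ∀ a : ι → ℝ, Integrable (fun g => a (f g)) μ := fun a =>
    Integrable.of_bound ((measurable_of_countable a).comp hf).aestronglyMeasurable (∑ j, ‖a j‖)
      (Eventually.of_forall fun g =>
        Finset.single_le_sum (f := fun j => ‖a j‖) (fun _ _ => norm_nonneg _) (Finset.mem_univ _))
  have hXj : ∀ j, (actAverage μ U ((A j).indicator fun _ => (1 : ℝ)) X).PosSemidef := fun j =>
    posSemidef_actAverage U (hAi j)
      (Eventually.of_forall fun g => Set.indicator_nonneg (fun _ _ => zero_le_one) g) hX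
  have hXle : (B - ∑ j, actAverage μ U ((A j).indicator fun _ => (1 : ℝ)) X).PosSemidef := by
    have h1 := hcomb fun _ => 1
    simp only [Complex.ofReal_one, one_smul] at h1
    rw [h1, hBdef, Efix_eq_actAverage, add_sub_right_comm]
    refine (posSemidef_actAverage_sub U ((hbdd fun _ => 1).indicator (measurableSet_fixSet S U))
      he.integrable (Eventually.of_forall fun g => ?_) hX).add hδ1.posSemidef
    by_cases hg : g ∈ fixSet S U
    · rw [fixDensity, Set.indicator_of_mem hg, Set.indicator_of_mem hg]
      exact (one_le_inv₀ (measureReal_fixSet_pos S U)).2 measureReal_le_one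
    · rw [fixDensity, Set.indicator_of_notMem hg, Set.indicator_of_notMem hg]
  have hTle : (∑ j, (c j : ℂ) • actAverage μ U ((A j).indicator fun _ => (1 : ℝ)) X -
      actAverage μ U κ X).PosSemidef := by
    rw [hcomb]
    refine posSemidef_actAverage_sub U hκ.integrable
      ((hbdd c).indicator (measurableSet_fixSet S U)) ?_ hX
    filter_upwards [hle, hκ.ae_mem] with g hg hg'
    by_cases hgf : g ∈ fixSet S U
    · rwa [Set.indicator_of_mem hgf]
    · rw [Set.indicator_of_notMem hgf]
      exact (not_not.1 (mt hg' hgf)).le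
  have hBfix : ∀ g ∈ fixSet S U, U.act g (mpow B (p - 1)) = mpow B (p - 1) := fun g hg =>
    U.act_cfc (by rw [hBdef, map_add, map_smul, act_Efix S U hg, U.act_one_right]) _
  have htr : (mpow B (p - 1) * X).trace.re ≤ (mpow B p).trace.re := by
    have h1 := trace_mul_re_nonneg (posSemidef_mpow hB.posSemidef (p - 1)) hδ1.posSemidef
    have h2 : mpow B p = mpow B (p - 1) * Efix S U X + mpow B (p - 1) * ((δ : ℂ) • 1) := by
      rw [← Matrix.mul_add, ← hBdef, mpow_mul_self hB.posSemidef (by linarith), sub_add_cancel]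
    rw [← trace_mul_Efix hBfix X, h2, Matrix.trace_add, Complex.add_re]
    exact le_add_of_nonneg_right h1
  have htrj : ∀ j, (mpow B (p - 1) * actAverage μ U ((A j).indicator fun _ => (1 : ℝ)) X).trace.re =
      (∫ g, (A j).indicator (fun _ => (1 : ℝ)) g ∂μ) * (mpow B (p - 1) * X).trace.re := by
    intro j
    rw [trace_mul_actAverage U (hAi j)]
    have : ∫ g, (((A j).indicator (fun _ => (1 : ℝ)) g : ℝ) : ℂ) *
        (mpow B (p - 1) * U.act g X).trace ∂μ =
        ∫ g, (((A j).indicator (fun _ => (1 : ℝ)) g : ℝ) : ℂ) * (mpow B (p - 1) * X).trace ∂μ := by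
      refine integral_congr_ae (Eventually.of_forall fun g => ?_)
      by_cases hg : g ∈ A j
      · simp only
        rw [← U.trace_act g (mpow B (p - 1) * X), ← U.act_mul_act, hBfix g hg.1]
      · simp [hg]
    rw [this, integral_mul_const, integral_complex_ofReal, Complex.re_ofReal_mul]
  refine (trace_mpow_mono (hκ.posSemidef_average hX) hTle hp).trans
    ((trace_mpow_sum_le hB hXj hXle hc hp).trans ?_)
  simp only [htrj, ← mul_assoc, ← Finset.sum_mul]
  -- The left side integrates only over the stabiliser; the complement contributes a nonnegative
  -- amount.
  have hint : ∑ j, c j ^ p * ∫ g, (A j).indicator (fun _ => (1 : ℝ)) g ∂μ ≤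
      ∫ g, c (f g) ^ p ∂μ := by
    simp only [← integral_const_mul]
    rw [← integral_finsetSum _ fun j _ => (hAi j).const_mul _]
    simp only [hsum fun j => c j ^ p]
    refine integral_mono ((hbdd fun j => c j ^ p).indicator (measurableSet_fixSet S U))
      (hbdd fun j => c j ^ p) fun g => ?_
    exact Set.indicator_le_self' (fun _ _ => Real.rpow_nonneg (hc _).le _) g
  refine (mul_le_mul_of_nonneg_left htr (Finset.sum_nonneg fun j _ => mul_nonneg
    (Real.rpow_nonneg (hc j).le _) (integral_nonneg fun g => ?_))).trans
    (mul_le_mul_of_nonneg_right hint (trace_mpow_nonneg hB.posSemidef p))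
  exact Set.indicator_nonneg (fun _ _ => zero_le_one) g

theorem integrable_rpow (hκ : IsFixDensity S U κ) {M : ℝ} (hM : ∀ᵐ g ∂μ, κ g ≤ M) {p : ℝ}
    (hp : 0 ≤ p) : Integrable (fun g => κ g ^ p) μ := by
  refine Integrable.of_bound (hκ.measurable.pow_const p).aestronglyMeasurable (M ^ p) ?_
  filter_upwards [hM] with g hg
  rw [Real.norm_of_nonneg (Real.rpow_nonneg (hκ.nonneg g) p)]
  exact Real.rpow_le_rpow (hκ.nonneg g) hg hp

/-- The `L_p` transference inequality `‖T(X)‖_p ≤ ‖κ‖_p ‖E(X)‖_p`. -/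
theorem trace_mpow_average_le (hκ : IsFixDensity S U κ) {M : ℝ} (hM : ∀ᵐ g ∂μ, κ g ≤ M)
    {X : Matrix n n ℂ} (hX : X.PosSemidef) {p : ℝ} (hp : 1 < p) :
    (mpow (actAverage μ U κ X) p).trace.re ≤
      (∫ g, κ g ^ p ∂μ) * (mpow (Efix S U X) p).trace.re := by
  have hp0 : 0 ≤ p := by linarith
  have hint : ∀ N : ℕ, ∀ᵐ g ∂μ, ‖(κ g + 1 / ((N : ℝ) + 1)) ^ p‖ ≤ (M + 1) ^ p := by
    intro N
    filter_upwards [hM] with g hg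
    have h0 : 0 < 1 / ((N : ℝ) + 1) := by positivity
    have h1 : 1 / ((N : ℝ) + 1) ≤ 1 := by
      rw [div_le_one (by positivity)]
      linarith [(Nat.cast_nonneg N : (0 : ℝ) ≤ N)]
    have h2 : 0 ≤ κ g + 1 / ((N : ℝ) + 1) := add_nonneg (hκ.nonneg g) h0.le
    rw [Real.norm_of_nonneg (Real.rpow_nonneg h2 p)]
    exact Real.rpow_le_rpow h2 (add_le_add hg h1) hp0
  have hmeas : ∀ N : ℕ, AEStronglyMeasurable (fun g => (κ g + 1 / ((N : ℝ) + 1)) ^ p) μ :=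
    fun N => ((hκ.measurable.add_const _).pow_const p).aestronglyMeasurable
  have hstep : ∀ N : ℕ, ∀ δ : ℝ, 0 < δ → (mpow (actAverage μ U κ X) p).trace.re ≤
      (∫ g, (κ g + 1 / ((N : ℝ) + 1)) ^ p ∂μ) *
        (mpow (Efix S U X + (δ : ℂ) • 1) p).trace.re := by
    intro N δ hδ
    have hN : (0 : ℝ) < (N : ℝ) + 1 := by positivity
    -- Rounding κ up on the grid of mesh 1/(N+1) gives κ ≤ c ∘ f ≤ κ + 1/(N+1). The extra +1 in c
    -- keeps the levels positive where κ = 0. `Fin.ofNat` reduces modulo K + 1, which changes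
    -- nothing where κ ≤ M.
    set K : ℕ := ⌊((N : ℝ) + 1) * M⌋₊
    set f : G → Fin (K + 1) := fun g => Fin.ofNat (K + 1) ⌊((N : ℝ) + 1) * κ g⌋₊ with hf
    set c : Fin (K + 1) → ℝ := fun j => ((j : ℕ) + 1) / ((N : ℝ) + 1) with hc
    have hfm : Measurable f := (measurable_of_countable (Fin.ofNat (K + 1))).comp
      (Nat.measurable_floor.comp (hκ.measurable.const_mul _))
    have hcf : ∀ᵐ g ∂μ, c (f g) = (⌊((N : ℝ) + 1) * κ g⌋₊ + 1) / ((N : ℝ) + 1) := by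
      filter_upwards [hM] with g hg
      have : ⌊((N : ℝ) + 1) * κ g⌋₊ < K + 1 :=
        Nat.lt_succ_of_le (Nat.floor_mono (mul_le_mul_of_nonneg_left hg hN.le))
      simp only [hc, hf, Fin.val_ofNat, Nat.mod_eq_of_lt this]
    refine (hκ.trace_mpow_average_le_of_le_simple hfm (c := c) (fun j => by positivity) ?_ hX hp
      hδ).trans ?_
    · filter_upwards [hcf] with g hg
      rw [hg, le_div_iff₀ hN, mul_comm]
      exact (Nat.lt_floor_add_one _).le
    · refine mul_le_mul_of_nonneg_right (integral_mono_of_nonneg ?_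
        (Integrable.of_bound (hmeas N) _ (hint N)) ?_) (trace_mpow_nonneg ?_ p)
      · exact Eventually.of_forall fun g => Real.rpow_nonneg (by positivity) p
      · filter_upwards [hcf] with g hg
        refine Real.rpow_le_rpow (by positivity) ?_ hp0
        rw [hg, add_div]
        refine add_le_add ?_ le_rfl
        rw [div_le_iff₀ hN, mul_comm (κ g)]
        exact Nat.floor_le (mul_nonneg hN.le (hκ.nonneg g))
      · exact (posSemidef_Efix S U hX).add
          (Matrix.PosSemidef.one.smul (Complex.zero_le_real.2 hδ.le))
  -- The limits are taken in turn: δ → 0 for fixed N, then N → ∞ by dominated convergence.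
  have hlim : ∀ N : ℕ, (mpow (actAverage μ U κ X) p).trace.re ≤
      (∫ g, (κ g + 1 / ((N : ℝ) + 1)) ^ p ∂μ) * (mpow (Efix S U X) p).trace.re := by
    intro N
    have h := ((tendsto_trace_mpow_add (posSemidef_Efix S U hX) hp).mono_left
      (nhdsWithin_le_nhds (s := Set.Ioi 0))).const_mul (∫ g, (κ g + 1 / ((N : ℝ) + 1)) ^ p ∂μ)
    exact ge_of_tendsto h (eventually_mem_nhdsWithin.mono fun δ hδ => hstep N δ hδ)
  have hconv : Tendsto (fun N : ℕ => ∫ g, (κ g + 1 / ((N : ℝ) + 1)) ^ p ∂μ) atTop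
      (𝓝 (∫ g, κ g ^ p ∂μ)) := by
    refine tendsto_integral_of_dominated_convergence (fun _ => (M + 1) ^ p) hmeas
      (integrable_const _) hint (Eventually.of_forall fun g => ?_)
    have h1 : Tendsto (fun N : ℕ => κ g + 1 / ((N : ℝ) + 1)) atTop (𝓝 (κ g)) := by
      simpa using tendsto_one_div_add_atTop_nhds_zero_nat.const_add (κ g)
    exact h1.rpow_const (Or.inr hp0)
  exact ge_of_tendsto' (hconv.mul_const _) hlim

end IsFixDensity

end inequalities

/-! ### The entropy as a derivative at `p = 1` -/

/-- At base 0 the power vanishes for all exponents near p > 0, in agreement with the convention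
`Real.log 0 = 0`. -/
theorem hasDerivAt_rpow_exponent {x : ℝ} (hx : 0 ≤ x) {p : ℝ} (hp : 0 < p) :
    HasDerivAt (fun s : ℝ => x ^ s) (x ^ p * Real.log x) p := by
  rcases hx.eq_or_lt with rfl | hx
  · have : (fun s : ℝ => (0 : ℝ) ^ s) =ᶠ[𝓝 p] fun _ => 0 := by
      filter_upwards [eventually_gt_nhds hp] with s hs
      exact Real.zero_rpow hs.ne'
    simpa using (hasDerivAt_const p (0 : ℝ)).congr_of_eventuallyEq this
  · exact (Real.hasStrictDerivAt_const_rpow hx p).hasDerivAt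

theorem le_of_hasDerivAt_of_le_right {f g : ℝ → ℝ} {f' g' a : ℝ} (hf : HasDerivAt f f' a)
    (hg : HasDerivAt g g' a) (ha : f a = g a) (hle : ∀ p, a < p → f p ≤ g p) : f' ≤ g' := by
  have h := (hasDerivAt_iff_tendsto_slope.1 (hg.sub hf)).mono_left
    (nhdsWithin_mono a fun x (hx : x ∈ Set.Ioi a) => (ne_of_gt hx : x ≠ a))
  refine sub_nonneg.1 (ge_of_tendsto h (eventually_mem_nhdsWithin.mono fun p hp => ?_))
  rw [slope_def_field]
  refine div_nonneg ?_ (sub_nonneg.2 (le_of_lt hp))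
  have := hle p hp
  simp only [Pi.sub_apply]
  linarith

theorem trace_mul_mlog_re {A : Matrix n n ℂ} (hA : A.IsHermitian) :
    (A * mlog A).trace.re = ∑ i, hA.eigenvalues i * Real.log (hA.eigenvalues i) := by
  rw [mlog]
  nth_rewrite 1 [← cfc_id ℝ A hA.isSelfAdjoint]
  rw [← cfc_mul _ _ A (continuousOn_spectrum _ _) (continuousOn_spectrum _ _), trace_cfc hA,
    ← Complex.ofReal_sum, Complex.ofReal_re]
  rfl

theorem hasDerivAt_trace_mpow {A : Matrix n n ℂ} (hA : A.PosSemidef) :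
    HasDerivAt (fun p => (mpow A p).trace.re) (A * mlog A).trace.re 1 := by
  simp only [trace_mpow_re hA.1]
  rw [trace_mul_mlog_re hA.1]
  refine HasDerivAt.fun_sum fun i _ => ?_
  simpa using hasDerivAt_rpow_exponent (hA.eigenvalues_nonneg i) one_pos

theorem mpow_one {A : Matrix n n ℂ} (hA : A.IsHermitian) : mpow A 1 = A := by
  simp only [mpow, Real.rpow_one]
  exact cfc_id' ℝ A hA.isSelfAdjoint

/-- A bound uniform in p near 1, for differentiating ∫ κ^p under the integral. The 2 bounds √x |log
x| on (0, 1]; for x ≥ 1 one has x^p ≤ M² and log x ≤ M. -/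
theorem rpow_mul_abs_log_le {x M p : ℝ} (hx : 0 ≤ x) (hxM : x ≤ M) (hM : 1 ≤ M)
    (hp : 1 / 2 ≤ p) (hp' : p ≤ 2) : x ^ p * |Real.log x| ≤ 2 + M ^ 2 * M := by
  have hM0 : 0 ≤ M ^ 2 * M := by positivity
  rcases hx.eq_or_lt with rfl | hx0
  · simp
    linarith
  rcases le_total x 1 with h1 | h1
  · have h2 := Real.abs_log_mul_self_rpow_lt x (1 / 2) hx0 h1 (by norm_num)
    rw [abs_mul, abs_of_nonneg (Real.rpow_nonneg hx (1 / 2)), mul_comm] at h2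
    have h3 : x ^ p ≤ x ^ (1 / 2 : ℝ) := Real.rpow_le_rpow_of_exponent_ge hx0 h1 hp
    have h4 := mul_le_mul_of_nonneg_right h3 (abs_nonneg (Real.log x))
    norm_num at h2 h4 ⊢
    linarith
  · have h2 : x ^ p ≤ M ^ 2 :=
      (Real.rpow_le_rpow_of_exponent_le h1 hp').trans (by rw [Real.rpow_two]; gcongr)
    have h3 : |Real.log x| ≤ M := by
      rw [abs_of_nonneg (Real.log_nonneg h1)]
      exact ((Real.log_le_sub_one_of_pos hx0).trans (by linarith)).trans hxM
    have := mul_le_mul h2 h3 (abs_nonneg _) (by positivity)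
    linarith

section entropy

variable [IsTopologicalGroup G] [CompactSpace G] [SecondCountableTopology G] [BorelSpace G]
variable {μ : Measure G} [μ.IsHaarMeasure] [IsProbabilityMeasure μ]
variable {S : MarkovSemigroup μ} {U : ProjectiveRep G n}

/-- E preserves the trace, so the two sides of `trace_mpow_Efix_le` agree at p = 1 and their right
derivatives there compare. -/
theorem entropy_Efix_le {X : Matrix n n ℂ} (hX : X.PosSemidef) :
    (Efix S U X * mlog (Efix S U X)).trace.re ≤ (X * mlog X).trace.re := by
  have hE := posSemidef_Efix S U hX
  refine le_of_hasDerivAt_of_le_right (hasDerivAt_trace_mpow hE) (hasDerivAt_trace_mpow hX) ?_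
    fun p hp => trace_mpow_Efix_le hX hp
  rw [mpow_one hE.1, mpow_one hX.1]
  have := trace_mul_Efix (S := S) (U := U) (fun g _ => U.act_one_right g) X
  rw [Matrix.one_mul, Matrix.one_mul] at this
  rw [this]

namespace IsFixDensity

variable {κ : G → ℝ}

theorem hasDerivAt_integral_rpow (hκ : IsFixDensity S U κ) {M : ℝ} (hM : ∀ᵐ g ∂μ, κ g ≤ M)
    (hM1 : 1 ≤ M) : Integrable (fun g => κ g * Real.log (κ g)) μ ∧
      HasDerivAt (fun p : ℝ => ∫ g, κ g ^ p ∂μ) (∫ g, κ g * Real.log (κ g) ∂μ) 1 := by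
  have h := hasDerivAt_integral_of_dominated_loc_of_deriv_le (μ := μ)
    (F := fun (p : ℝ) g => κ g ^ p) (F' := fun (p : ℝ) g => κ g ^ p * Real.log (κ g)) (x₀ := 1)
    (s := Set.Ioo (1 / 2 : ℝ) 2) (bound := fun _ => 2 + M ^ 2 * M)
    (Ioo_mem_nhds (by norm_num) (by norm_num))
    (Eventually.of_forall fun p => (hκ.measurable.pow_const p).aestronglyMeasurable)
    (hκ.integrable_rpow hM zero_le_one)
    ((hκ.measurable.pow_const (1 : ℝ)).mul hκ.measurable.log).aestronglyMeasurable
    (by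
      filter_upwards [hM] with g hg p hp
      rw [norm_mul, Real.norm_of_nonneg (Real.rpow_nonneg (hκ.nonneg g) p)]
      exact rpow_mul_abs_log_le (hκ.nonneg g) hg hM1 hp.1.le hp.2.le)
    (integrable_const _)
    (Eventually.of_forall fun g p hp =>
      hasDerivAt_rpow_exponent (hκ.nonneg g) (by linarith [hp.1]))
  simpa using h

/-- Both sides of the L_p transference inequality equal 1 at p = 1. The product rule on the
right-hand side splits its derivative into the two entropy terms. -/
theorem entropy_average_le (hκ : IsFixDensity S U κ) {M : ℝ} (hM : ∀ᵐ g ∂μ, κ g ≤ M)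
    (hM1 : 1 ≤ M) {X : Matrix n n ℂ} (hX : X.PosSemidef) (hX1 : X.trace = 1) :
    (actAverage μ U κ X * mlog (actAverage μ U κ X)).trace.re ≤
      (Efix S U X * mlog (Efix S U X)).trace.re + ∫ g, κ g * Real.log (κ g) ∂μ := by
  have hE := posSemidef_Efix S U hX
  have hT := hκ.posSemidef_average hX
  have h1 : ∀ g ∈ fixSet S U, U.act g 1 = 1 := fun g _ => U.act_one_right g
  have hEt := trace_mul_Efix h1 X
  have hTt := hκ.trace_mul_average h1 X
  rw [Matrix.one_mul, Matrix.one_mul, hX1] at hEt hTt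
  have hd := (hκ.hasDerivAt_integral_rpow hM hM1).2.mul (hasDerivAt_trace_mpow hE)
  have h := le_of_hasDerivAt_of_le_right (hasDerivAt_trace_mpow hT) hd ?_
    fun p hp => hκ.trace_mpow_average_le hM hX hp
  · simp only [Real.rpow_one] at h
    rw [mpow_one hE.1, hEt, hκ.integral_eq_one, one_mul, Complex.one_re, mul_one] at h
    linarith
  · simp only [Pi.mul_apply, Real.rpow_one]
    rw [mpow_one hE.1, mpow_one hT.1, hEt, hTt, hκ.integral_eq_one, one_mul]

end IsFixDensity

end entropy

/-! ### The mixing time is attained -/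

/-- Comparison of integrable functions by testing against nonnegative continuous functions. -/
theorem ae_le_of_forall_integral_mul_le {X : Type*} [TopologicalSpace X]
    [TopologicalSpace.PseudoMetrizableSpace X] [MeasurableSpace X] [BorelSpace X]
    {μ : Measure X} [IsFiniteMeasure μ] {φ ψ : X → ℝ} (hφm : Measurable φ) (hψm : Measurable ψ)
    (hφ : Integrable φ μ) (hψ : Integrable ψ μ)
    (h : ∀ f : X → ℝ, Continuous f → (∀ x, 0 ≤ f x) → (∃ C, ∀ x, |f x| ≤ C) →
      ∫ x, φ x * f x ∂μ ≤ ∫ x, ψ x * f x ∂μ) : φ ≤ᵐ[μ] ψ := by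
  -- Indicators of closed sets are pointwise limits of continuous functions with values in [0, 1].
  have hclosed : ∀ F : Set X, IsClosed F → ∫ x in F, φ x ∂μ ≤ ∫ x in F, ψ x ∂μ := by
    intro F hF
    have hlim : ∀ θ : X → ℝ, Integrable θ μ →
        Tendsto (fun N => ∫ x, θ x * (hF.apprSeq N x : ℝ) ∂μ) atTop (𝓝 (∫ x in F, θ x ∂μ)) := by
      intro θ hθ
      rw [← integral_indicator hF.measurableSet]
      refine tendsto_integral_of_dominated_convergence (fun x => ‖θ x‖) (fun N => ?_) hθ.norm
        (fun N => Eventually.of_forall fun x => ?_) (Eventually.of_forall fun x => ?_)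
      · exact hθ.aestronglyMeasurable.mul
          (NNReal.continuous_coe.comp (hF.apprSeq N).continuous).measurable.aestronglyMeasurable
      · rw [norm_mul]
        refine mul_le_of_le_one_right (norm_nonneg _) ?_
        rw [Real.norm_of_nonneg NNReal.zero_le_coe]
        exact_mod_cast HasOuterApproxClosed.apprSeq_apply_le_one hF N x
      · have h1 := (tendsto_pi_nhds.1 (HasOuterApproxClosed.tendsto_apprSeq hF)) x
        have h2 := ((NNReal.tendsto_coe.2 h1).const_mul (θ x))
        by_cases hx : x ∈ F
        · simpa [hx] using h2
        · simpa [hx] using h2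
    refine le_of_tendsto_of_tendsto' (hlim φ hφ) (hlim ψ hψ) fun N => h _
      (NNReal.continuous_coe.comp (hF.apprSeq N).continuous) (fun x => NNReal.zero_le_coe) ⟨1, ?_⟩
    intro x
    rw [abs_of_nonneg NNReal.zero_le_coe]
    exact_mod_cast HasOuterApproxClosed.apprSeq_apply_le_one hF N x
  by_contra hc
  have hm : MeasurableSet {x | ¬ φ x ≤ ψ x} := (measurableSet_le hφm hψm).compl
  have hpos : 0 < μ {x | ¬ φ x ≤ ψ x} := pos_iff_ne_zero.2 hc
  -- Inner regularity places a closed set of positive measure inside the bad set, which contradicts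
  -- `hclosed`.
  obtain ⟨F, hFs, hF, hF0⟩ := hm.exists_lt_isClosed_of_ne_top (measure_ne_top _ _) hpos
  have h1 : 0 < ∫ x in F, (φ x - ψ x) ∂μ := by
    rw [setIntegral_pos_iff_support_of_nonneg_ae]
    · refine hF0.trans_le (measure_mono fun x hx => ⟨?_, hx⟩)
      exact (sub_pos.2 (not_le.1 (hFs hx))).ne'
    · filter_upwards [ae_restrict_mem hF.measurableSet] with x hx
      exact (sub_pos.2 (not_le.1 (hFs hx))).le
    · exact (hφ.sub hψ).integrableOn
  rw [integral_sub hφ.integrableOn hψ.integrableOn] at h1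
  linarith [hclosed F hF]

section mixing

variable [IsTopologicalGroup G] [CompactSpace G] [T2Space G] [SecondCountableTopology G]
variable [BorelSpace G] {μ : Measure G} [μ.IsHaarMeasure] [IsProbabilityMeasure μ]
variable (S : MarkovSemigroup μ)

theorem measureReal_singleton_one_pos [Finite G] : 0 < μ.real {(1 : G)} :=
  ENNReal.toReal_pos ((isOpen_discrete _).measure_ne_zero μ (Set.singleton_nonempty _))
    (measure_ne_top _ _)

/-- The kernel at time `0` on a finite group. -/
theorem k_zero_inv [Finite G] (g : G) :
    S.k 0 g⁻¹ = ({1} : Set G).indicator (fun _ => (μ.real {(1 : G)})⁻¹) g := by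
  have h := S.zero ‹_› (({1} : Set G).indicator fun _ => 1) g⁻¹
  have h1 : ∀ x, S.K 0 g⁻¹ x * ({1} : Set G).indicator (fun _ => 1) x =
      ({1} : Set G).indicator (fun _ => S.K 0 g⁻¹ 1) x := by
    intro x
    by_cases hx : x = 1
    · simp [hx]
    · simp [hx]
  simp only [h1] at h
  rw [integral_indicator_const _ (measurableSet_singleton 1), smul_eq_mul] at h
  have hp := (measureReal_singleton_one_pos (G := G) (μ := μ)).ne'
  rw [MarkovSemigroup.k, eq_comm]
  by_cases hg : g = 1
  · subst hg
    simp only [inv_one, Set.mem_singleton_iff, Set.indicator_of_mem] at h ⊢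
    rw [inv_eq_iff_eq_inv]
    exact eq_inv_of_mul_eq_one_left h
  · simp only [Set.mem_singleton_iff, inv_eq_one, hg, not_false_eq_true,
      Set.indicator_of_notMem] at h ⊢
    exact ((mul_eq_zero.1 h).resolve_left hp).symm

theorem isFixDensity_k_inv_of_isKernelTime (U : ProjectiveRep G n) {t : ℝ≥0}
    (ht : IsKernelTime G t) : IsFixDensity S U fun g => S.k t g⁻¹ := by
  rcases eq_or_ne t 0 with rfl | h0
  · have : Finite G := ht.resolve_left (lt_irrefl _)
    simp only [k_zero_inv]
    refine ⟨measurable_const.indicator (measurableSet_singleton 1),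
      fun g => Set.indicator_nonneg (fun _ _ => inv_nonneg.2 measureReal_nonneg) g,
      (integrable_const _).indicator (measurableSet_singleton 1), ?_,
      Eventually.of_forall fun g hg => ?_⟩
    · rw [integral_indicator_const _ (measurableSet_singleton 1), smul_eq_mul,
        mul_inv_cancel₀ measureReal_singleton_one_pos.ne']
    · rw [Set.mem_singleton_iff.1 (Set.mem_of_indicator_ne_zero hg)]
      exact one_mem_fixSet S U
  · exact isFixDensity_k_inv S U (pos_iff_ne_zero.2 h0)

theorem transferred_eq_of_isKernelTime (U : ProjectiveRep G n) {t : ℝ≥0}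
    (ht : IsKernelTime G t) (x : Matrix n n ℂ) :
    transferred S U t x = actAverage μ U (fun g => S.k t g⁻¹) x := by
  rcases eq_or_ne t 0 with rfl | h0
  · have : Finite G := ht.resolve_left (lt_irrefl _)
    simp only [k_zero_inv]
    have h1 : ∀ g, ((({1} : Set G).indicator (fun _ => (μ.real {(1 : G)})⁻¹) g : ℝ) : ℂ) •
        U.act g x = ({1} : Set G).indicator (fun _ => (μ.real {(1 : G)})⁻¹ • x) g := by
      intro g
      by_cases hg : g = 1
      · simp only [hg, Set.mem_singleton_iff, Set.indicator_of_mem, U.act_one]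
        rfl
      · simp [hg]
    rw [actAverage]
    simp only [h1]
    rw [integral_indicator_const _ (measurableSet_singleton 1), smul_smul,
      mul_inv_cancel₀ measureReal_singleton_one_pos.ne', one_smul]
    change transferredFun S U 0 x = x
    simp [transferredFun]
  · exact transferred_eq_actAverage S U (pos_iff_ne_zero.2 h0) x

theorem measurable_k_inv {t : ℝ≥0} (ht : IsKernelTime G t) : Measurable fun g => S.k t g⁻¹ := by
  rcases ht with h0 | hfin
  · exact ((S.measurable t h0).comp measurable_prodMk_right).comp measurable_inv
  · exact measurable_of_countable _

theorem integrable_k_inv_mul {t : ℝ≥0} (ht : IsKernelTime G t) {f : G → ℝ} {C : ℝ}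
    (hf : AEStronglyMeasurable f μ) (hC : ∀ g, |f g| ≤ C) :
    Integrable (fun g => S.k t g⁻¹ * f g) μ := by
  rcases ht with h0 | hfin
  · exact (S.integrable_k_inv h0).mul_bdd (c := C) hf (Eventually.of_forall hC)
  · exact Integrable.of_finite

theorem kernelOp_one_eq {t : ℝ≥0} (ht : IsKernelTime G t) (f : G → ℝ) :
    kernelOp μ S.K t f 1 = ∫ g, S.k t g⁻¹ * f g ∂μ := by
  rcases eq_or_ne t 0 with rfl | h0
  · have : Finite G := ht.resolve_left (lt_irrefl _)
    have h1 : ∀ g, S.k 0 g⁻¹ * f g =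
        ({1} : Set G).indicator (fun _ => (μ.real {(1 : G)})⁻¹ * f 1) g := by
      intro g
      rw [k_zero_inv]
      by_cases hg : g = 1
      · simp [hg]
      · simp [hg]
    simp only [h1]
    rw [integral_indicator_const _ (measurableSet_singleton 1), smul_eq_mul, ← mul_assoc,
      mul_inv_cancel₀ measureReal_singleton_one_pos.ne', one_mul, kernelOp, if_pos rfl]
  · rw [kernelOp, if_neg h0]
    refine integral_congr_ae (Eventually.of_forall fun h => ?_)
    have := S.right_invariant t (pos_iff_ne_zero.2 h0) 1 h h⁻¹
    simp only [MarkovSemigroup.k]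
    rw [← this, mul_inv_cancel, one_mul]

/-! ### Regularity of the semigroup in time and attainment of the mixing time -/

theorem integrable_K {t : ℝ≥0} (ht : 0 < t) (g : G) : Integrable (S.K t g) μ := by
  by_contra hc
  have := S.mass t ht g
  rw [integral_undef hc] at this
  exact zero_ne_one this

theorem abs_kernelOp_le {t : ℝ≥0} {f : G → ℝ} {C : ℝ} (hC : ∀ g, |f g| ≤ C) (g : G) :
    |kernelOp μ S.K t f g| ≤ C := by
  rcases eq_or_ne t 0 with rfl | h0
  · rw [kernelOp, if_pos rfl]
    exact hC g
  · have ht := pos_iff_ne_zero.2 h0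
    rw [kernelOp, if_neg h0]
    have hb : ∀ h, ‖S.K t g h * f h‖ ≤ S.K t g h * C := fun h => ?_
    · refine (norm_integral_le_of_norm_le ((integrable_K S ht g).mul_const C)
        (Eventually.of_forall hb)).trans (le_of_eq ?_)
      rw [integral_mul_const, S.mass t ht g, one_mul]
    · rw [norm_mul, Real.norm_of_nonneg (S.nonneg t ht g h)]
      exact mul_le_mul_of_nonneg_left (hC h) (S.nonneg t ht g h)

theorem measurable_kernelOp {t : ℝ≥0} {f : G → ℝ} (hf : Measurable f) :
    Measurable (kernelOp μ S.K t f) := by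
  rcases eq_or_ne t 0 with rfl | h0
  · have : kernelOp μ S.K 0 f = f := by
      funext g
      simp [kernelOp]
    rwa [this]
  · have : kernelOp μ S.K t f = fun g => ∫ h, S.K t g h * f h ∂μ := by
      funext g
      simp [kernelOp, h0]
    rw [this]
    have h1 : Measurable (Function.uncurry fun g h => S.K t g h * f h) :=
      (S.measurable t (pos_iff_ne_zero.2 h0)).mul (hf.comp measurable_snd)
    exact h1.stronglyMeasurable.integral_prod_right.measurable

/-- Right continuity of the semigroup on continuous functions. -/
theorem tendsto_kernelOp (t : ℝ≥0) {f : G → ℝ} (hf : Continuous f) :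
    Tendsto (fun s => kernelOp μ S.K s f 1) (𝓝[>] t) (𝓝 (kernelOp μ S.K t f 1)) := by
  obtain ⟨C, hC⟩ := isCompact_univ.exists_bound_of_continuousOn hf.continuousOn
  have hC' : ∀ g, |f g| ≤ C := fun g => hC g (Set.mem_univ g)
  -- Since S_{t+δ} = S_t S_δ, continuity at 0 suffices; S_t is taken through the limit by dominated
  -- convergence.
  have h0 : Tendsto (fun δ => kernelOp μ S.K (t + δ) f 1) (𝓝[>] 0) (𝓝 (kernelOp μ S.K t f 1)) := by
    have hs : ∀ δ, kernelOp μ S.K (t + δ) f 1 = kernelOp μ S.K t (kernelOp μ S.K δ f) 1 :=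
      fun δ => S.semigroup t δ f hf.measurable ⟨C, hC'⟩ 1
    simp only [hs]
    rcases eq_or_ne t 0 with rfl | ht
    · have h1 : ∀ F : G → ℝ, kernelOp μ S.K 0 F 1 = F 1 := fun F => if_pos rfl
      simp only [h1]
      exact S.continuous f hf 1
    · have ht' := pos_iff_ne_zero.2 ht
      rw [kernelOp, if_neg ht]
      have h1 : ∀ F : G → ℝ, kernelOp μ S.K t F 1 = ∫ h, S.K t 1 h * F h ∂μ := fun F => by
        rw [kernelOp, if_neg ht]
      simp only [h1]
      refine tendsto_integral_filter_of_dominated_convergence (fun h => S.K t 1 h * C)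
        (Eventually.of_forall fun δ => ?_)
        (Eventually.of_forall fun δ => Eventually.of_forall fun h => ?_)
        ((integrable_K S ht' 1).mul_const C)
        (Eventually.of_forall fun h => (S.continuous f hf h).const_mul _)
      · exact (integrable_K S ht' 1).aestronglyMeasurable.mul
          (measurable_kernelOp S hf.measurable).aestronglyMeasurable
      · rw [norm_mul, Real.norm_of_nonneg (S.nonneg t ht' 1 h)]
        exact mul_le_mul_of_nonneg_left (abs_kernelOp_le S hC' h) (S.nonneg t ht' 1 h)
  have hsub : Tendsto (fun s : ℝ≥0 => s - t) (𝓝[>] t) (𝓝[>] 0) := by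
    refine tendsto_nhdsWithin_iff.2 ⟨?_, eventually_mem_nhdsWithin.mono fun s hs =>
      tsub_pos_of_lt (Set.mem_Ioi.1 hs)⟩
    have : Continuous fun s : ℝ≥0 => s - t := continuous_id.sub continuous_const
    simpa using this.continuousAt.tendsto.mono_left (nhdsWithin_le_nhds (a := t))
  refine (h0.comp hsub).congr' (eventually_mem_nhdsWithin.mono fun s hs => ?_)
  simp only [Function.comp_apply, add_tsub_cancel_of_le (le_of_lt (Set.mem_Ioi.1 hs))]

/-- Haar measure on a compact group is inversion invariant. The condition 0 ≤ ε matters because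
`ENNReal.ofReal` truncates negative values. -/
theorem ae_abs_sub_one_le_iff {k : G → ℝ} {ε : ℝ} (hε : 0 ≤ ε) :
    eLpNorm (fun g => k g - 1) ∞ μ ≤ ENNReal.ofReal ε ↔ ∀ᵐ g ∂μ, |k g⁻¹ - 1| ≤ ε := by
  have : μ.IsInvInvariant := isInvInvariant_of_compact
  have hinv : (∀ᵐ g ∂μ, |k g⁻¹ - 1| ≤ ε) ↔ ∀ᵐ g ∂μ, |k g - 1| ≤ ε := by
    have h1 : ∀ p : G → Prop, (∀ᵐ g ∂μ, p g) → ∀ᵐ g ∂μ, p g⁻¹ := fun p hp =>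
      (Measure.measurePreserving_inv μ).quasiMeasurePreserving.ae hp
    exact ⟨fun h => by simpa using h1 _ h, fun h => h1 _ h⟩
  rw [hinv, eLpNorm_exponent_top]
  constructor
  · intro h
    filter_upwards [enorm_ae_le_eLpNormEssSup (fun g => k g - 1) μ] with g hg
    have h2 := hg.trans h
    rwa [← ofReal_norm, ENNReal.ofReal_le_ofReal_iff hε, Real.norm_eq_abs] at h2
  · intro h
    refine essSup_le_of_ae_le _ (h.mono fun g hg => ?_)
    simp only [← ofReal_norm]
    exact ENNReal.ofReal_le_ofReal hg

/-- The norm condition is equivalent to a family of closed conditions on the numbers S_t f(1) with f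
≥ 0 continuous, and these survive limits from the right. A limit at time 0 on an infinite group must
be excluded separately. -/
theorem tEps_mem_mixingTimes {ε : ℝ} (hε : 0 < ε) (hfin : (S.mixingTimes ε).Nonempty) :
    S.tEps ε ∈ S.mixingTimes ε := by
  have : TopologicalSpace.PseudoMetrizableSpace G :=
    (TopologicalSpace.metrizableSpace_of_t3_secondCountable G).toPseudoMetrizableSpace
  by_cases hmem : S.tEps ε ∈ S.mixingTimes ε
  · exact hmem
  set t := S.tEps ε with htdef
  -- An infimum outside the set is approached by its elements strictly from the right.
  have hfreq : ∃ᶠ s in 𝓝[>] t, s ∈ S.mixingTimes ε := by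
    rw [frequently_iff]
    intro V hV
    obtain ⟨u, hu, hVu⟩ := (mem_nhdsGT_iff_exists_Ioo_subset).1 hV
    obtain ⟨s, hs, hsu⟩ := exists_lt_of_csInf_lt hfin (show sInf (S.mixingTimes ε) < u from hu)
    have hts : t ≤ s := csInf_le (OrderBot.bddBelow _) hs
    exact ⟨s, hVu ⟨lt_of_le_of_ne hts fun h => hmem (h ▸ hs), hsu⟩, hs⟩
  have hkey : ∀ f : G → ℝ, Continuous f → (∀ g, 0 ≤ f g) →
      |kernelOp μ S.K t f 1 - ∫ g, f g ∂μ| ≤ ε * ∫ g, f g ∂μ := by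
    intro f hf hf0
    have hfi : Integrable f μ := hf.integrable_of_hasCompactSupport
      (HasCompactSupport.of_compactSpace f)
    have hclosed : IsClosed {y : ℝ | |y - ∫ g, f g ∂μ| ≤ ε * ∫ g, f g ∂μ} :=
      isClosed_le (by fun_prop) continuous_const
    refine hclosed.mem_of_frequently_of_tendsto (hfreq.mono fun s hs => ?_)
      (tendsto_kernelOp S t hf)
    have hs2 := (ae_abs_sub_one_le_iff hε.le).1 hs.2
    have hb : ∀ᵐ g ∂μ, ‖(S.k s g⁻¹ - 1) * f g‖ ≤ ε * f g := hs2.mono fun g hg => by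
      rw [norm_mul, Real.norm_of_nonneg (hf0 g), Real.norm_eq_abs]
      exact mul_le_mul_of_nonneg_right hg (hf0 g)
    have h2 := norm_integral_le_of_norm_le (hfi.const_mul ε) hb
    rw [integral_const_mul] at h2
    obtain ⟨C, hC⟩ := isCompact_univ.exists_bound_of_continuousOn hf.continuousOn
    have hki : Integrable (fun g => S.k s g⁻¹ * f g) μ :=
      integrable_k_inv_mul S hs.1 hf.aestronglyMeasurable fun g => hC g (Set.mem_univ g)
    rw [Set.mem_ofPred_eq, kernelOp_one_eq S hs.1, ← integral_sub hki hfi]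
    simpa [sub_mul] using h2
  -- If t = 0, test functions shrinking to the indicator of {1} give 1 ≤ (1 + ε) μ{1}. Then {1} is
  -- an atom, so G is discrete, and being compact it is finite.
  have htime : IsKernelTime G t := by
    by_contra hnt
    obtain ⟨ht0, hinf⟩ := not_or.1 hnt
    have ht0 : t = 0 := le_antisymm (not_lt.1 ht0) zero_le
    have hone : ∀ N, (1 : ℝ) ≤ (1 + ε) *
        ∫ g, ((isClosed_singleton (x := (1 : G))).apprSeq N g : ℝ) ∂μ := by
      intro N
      have h := hkey _ (NNReal.continuous_coe.comp
        ((isClosed_singleton (x := (1 : G))).apprSeq N).continuous) fun g => NNReal.zero_le_coe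
      rw [kernelOp, if_pos ht0] at h
      have h1 : (isClosed_singleton (x := (1 : G))).apprSeq N 1 = 1 :=
        HasOuterApproxClosed.apprSeq_apply_eq_one _ N (Set.mem_singleton _)
      simp only [Function.comp_apply, h1, NNReal.coe_one] at h
      linarith [(abs_le.1 h).2]
    have hlim : Tendsto (fun N => ∫ g, ((isClosed_singleton (x := (1 : G))).apprSeq N g : ℝ) ∂μ)
        atTop (𝓝 (μ.real {(1 : G)})) := by
      have h := HasOuterApproxClosed.tendsto_lintegral_apprSeq (isClosed_singleton (x := (1 : G))) μ
      have h2 := (ENNReal.tendsto_toReal (measure_ne_top μ _)).comp h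
      refine h2.congr fun N => ?_
      rw [integral_eq_lintegral_of_nonneg_ae (Eventually.of_forall fun g => NNReal.zero_le_coe)
        (NNReal.continuous_coe.comp
          ((isClosed_singleton (x := (1 : G))).apprSeq N).continuous).aestronglyMeasurable]
      simp
    have h1 : (1 : ℝ) ≤ (1 + ε) * μ.real {(1 : G)} :=
      ge_of_tendsto' (hlim.const_mul _) hone
    have hdisc : IsOpen ({1} : Set G) := by
      by_contra hno
      have : (𝓝[≠] (1 : G)).NeBot := by
        refine neBot_iff.2 fun h => hno (isOpen_singleton_iff_punctured_nhds 1 |>.2 h)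
      have h2 : μ {(1 : G)} = 0 := measure_singleton _
      rw [measureReal_def, h2, ENNReal.toReal_zero, mul_zero] at h1
      linarith
    have := discreteTopology_of_isOpen_singleton_one hdisc
    exact hinf finite_of_compact_of_discrete
  have hm := measurable_k_inv S htime
  have hi : Integrable (fun g => S.k t g⁻¹) μ := by
    simpa using integrable_k_inv_mul S htime (f := fun _ => 1) (C := 1)
      aestronglyMeasurable_const (fun _ => by simp)
  have hle : (fun g => S.k t g⁻¹) ≤ᵐ[μ] fun _ => 1 + ε := by
    refine ae_le_of_forall_integral_mul_le hm measurable_const hi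
      (integrable_const _) fun f hf hf0 _ => ?_
    rw [← kernelOp_one_eq S htime, integral_const_mul]
    linarith [(abs_le.1 (hkey f hf hf0)).2]
  have hge : (fun _ => 1) ≤ᵐ[μ] fun g => S.k t g⁻¹ + ε := by
    refine ae_le_of_forall_integral_mul_le measurable_const (hm.add_const _)
      (integrable_const _) (hi.add (integrable_const _)) fun f hf hf0 hb => ?_
    obtain ⟨C, hC⟩ := hb
    have hfi : Integrable f μ := hf.integrable_of_hasCompactSupport
      (HasCompactSupport.of_compactSpace f)
    have hki : Integrable (fun g => S.k t g⁻¹ * f g) μ :=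
      integrable_k_inv_mul S htime hf.aestronglyMeasurable hC
    simp only [add_mul, one_mul]
    rw [integral_add hki (hfi.const_mul ε), ← kernelOp_one_eq S htime, integral_const_mul]
    linarith [(abs_le.1 (hkey f hf hf0)).1]
  refine ⟨htime, (ae_abs_sub_one_le_iff hε.le).2 ?_⟩
  filter_upwards [hle, hge] with g h1 h2
  exact abs_le.2 ⟨by linarith, by linarith⟩

end mixing

/-! ### Divergences -/

/-- The projection onto the kernel of a Hermitian matrix. -/
def kerProj (σ : Matrix n n ℂ) : Matrix n n ℂ := cfc (fun x : ℝ => if x = 0 then 1 else 0) σ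

/-- The kernel projection of a fixed state is invariant, so in this trace form the support condition
is unchanged by T and by E. -/
theorem kerLE_iff_trace_eq_zero {σ ρ : Matrix n n ℂ} (hσ : σ.PosSemidef) (hρ : ρ.PosSemidef) :
    KerLE σ ρ ↔ (kerProj σ * ρ).trace = 0 := by
  set Q := kerProj σ with hQ
  have hQh : Qᴴ = Q := (isHermitian_cfc σ _).eq
  have hσQ : σ * Q = 0 := by
    rw [hQ, kerProj]
    nth_rewrite 1 [← cfc_id ℝ σ hσ.1.isSelfAdjoint]
    rw [← cfc_mul _ _ σ (continuousOn_spectrum _ _) (continuousOn_spectrum _ _)]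
    have : (fun x : ℝ => id x * (if x = 0 then 1 else 0)) = fun _ => 0 := by
      funext x
      by_cases hx : x = 0 <;> simp [hx]
    rw [this, cfc_const_zero]
  have hQQ : Q * Q = Q := by
    rw [hQ, kerProj, ← cfc_mul _ _ σ (continuousOn_spectrum _ _) (continuousOn_spectrum _ _)]
    congr 1
    funext x
    by_cases hx : x = 0 <;> simp [hx]
  -- With `0⁻¹ = 0` this is σ⁻¹σ plus the kernel projection, so σ v = 0 yields Q v = v.
  have hinv : cfc (fun x : ℝ => x⁻¹) σ * σ + Q = 1 := by
    nth_rewrite 2 [← cfc_id ℝ σ hσ.1.isSelfAdjoint]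
    rw [← cfc_mul _ _ σ (continuousOn_spectrum _ _) (continuousOn_spectrum _ _), hQ, kerProj,
      ← cfc_add σ _ _ (continuousOn_spectrum _ _) (continuousOn_spectrum _ _)]
    have : (fun x : ℝ => x⁻¹ * id x + (if x = 0 then 1 else 0)) = fun _ => 1 := by
      funext x
      by_cases hx : x = 0 <;> simp [hx]
    rw [this, cfc_const_one ℝ σ hσ.1.isSelfAdjoint]
  constructor
  · intro h
    have h1 : ρ * Q = 0 := by
      refine Matrix.toLin'.injective (LinearMap.ext fun v => ?_)
      rw [Matrix.toLin'_apply, ← Matrix.mulVec_mulVec, map_zero, LinearMap.zero_apply]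
      refine h _ ?_
      rw [Matrix.mulVec_mulVec, hσQ, Matrix.zero_mulVec]
    rw [Matrix.trace_mul_comm, h1, Matrix.trace_zero]
  · intro h v hv
    obtain ⟨Y, rfl⟩ : ∃ Y : Matrix n n ℂ, ρ = Yᴴ * Y := by
      open scoped MatrixOrder in
      exact CStarAlgebra.nonneg_iff_eq_star_mul_self.1 (Matrix.nonneg_iff_posSemidef.2 hρ)
    have h1 : ((Y * Q)ᴴ * (Y * Q)).trace = 0 := by
      rw [Matrix.conjTranspose_mul, hQh]
      rw [show Q * Yᴴ * (Y * Q) = (Q * (Yᴴ * Y)) * Q by simp only [Matrix.mul_assoc],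
        Matrix.trace_mul_comm, ← Matrix.mul_assoc, hQQ, h]
    have h2 := Matrix.trace_conjTranspose_mul_self_eq_zero_iff.1 h1
    have h3 : Q *ᵥ v = v := by
      have := congrArg (· *ᵥ v) hinv
      simpa [Matrix.add_mulVec, ← Matrix.mulVec_mulVec, hv] using this
    rw [← h3, Matrix.mulVec_mulVec, Matrix.mul_assoc, h2, Matrix.mul_zero, Matrix.zero_mulVec]

/-- The degenerate case a = 0 forces b = 0, where `Real.log 0 = 0` and I ≥ 1 save both inequalities.
-/
theorem log_le_log_and_log_le_add {a b I : ℝ} (ha : 0 ≤ a) (hab : a ≤ b) (hI : 1 ≤ I)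
    (hb : b ≤ I * a) : Real.log a ≤ Real.log b ∧ Real.log b ≤ Real.log a + Real.log I := by
  rcases ha.eq_or_lt with rfl | ha
  · have : b = 0 := le_antisymm (by simpa using hb) hab
    simp [this, Real.log_nonneg hI]
  · refine ⟨Real.log_le_log ha hab, ?_⟩
    rw [← Real.log_mul ha.ne' (by linarith), mul_comm a I]
    exact Real.log_le_log (ha.trans_le hab) hb

section divergences

variable [IsTopologicalGroup G] [CompactSpace G] [SecondCountableTopology G] [BorelSpace G]
variable {μ : Measure G} [μ.IsHaarMeasure] [IsProbabilityMeasure μ]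
variable {S : MarkovSemigroup μ} {U : ProjectiveRep G n}

theorem IsFixState.act_eq {σ : Matrix n n ℂ} (hσ : IsFixState S U σ) {g : G}
    (hg : g ∈ fixSet S U) : U.act g σ = σ := by
  rw [← hσ.2]
  exact act_Efix S U hg σ

theorem kerLE_Efix_iff {σ ρ : Matrix n n ℂ} (hσ : IsFixState S U σ) (hρ : ρ.PosSemidef) :
    KerLE σ (Efix S U ρ) ↔ KerLE σ ρ := by
  rw [kerLE_iff_trace_eq_zero hσ.1.1 hρ,
    kerLE_iff_trace_eq_zero hσ.1.1 (posSemidef_Efix S U hρ)]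
  rw [trace_mul_Efix (fun g hg => ?_)]
  exact U.act_cfc (hσ.act_eq hg) _

theorem Efix_mul_mul {a : Matrix n n ℂ} (ha : ∀ g ∈ fixSet S U, U.act g a = a)
    (x : Matrix n n ℂ) : Efix S U (a * x * a) = a * Efix S U x * a := by
  rw [Efix_eq_actAverage, Efix_eq_actAverage]
  exact (isFixDensity_fixDensity S U).average_mul_mul ha ha x

namespace IsFixDensity

variable {κ : G → ℝ}

theorem kerLE_average_iff (hκ : IsFixDensity S U κ) {σ ρ : Matrix n n ℂ} (hσ : IsFixState S U σ)
    (hρ : ρ.PosSemidef) : KerLE σ (actAverage μ U κ ρ) ↔ KerLE σ ρ := by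
  rw [← kerLE_Efix_iff hσ hρ, ← hκ.Efix_average ρ, kerLE_Efix_iff hσ (hκ.posSemidef_average hρ)]

theorem one_le_of_ae_le (hκ : IsFixDensity S U κ) {M : ℝ} (hM : ∀ᵐ g ∂μ, κ g ≤ M) : 1 ≤ M := by
  have := integral_mono_ae hκ.integrable (integrable_const M) hM
  rw [hκ.integral_eq_one] at this
  simpa using this

/-- Bernoulli's inequality κ^p ≥ 1 + p(κ - 1), integrated against a probability measure. -/
theorem one_le_integral_rpow (hκ : IsFixDensity S U κ) {M : ℝ} (hM : ∀ᵐ g ∂μ, κ g ≤ M) {p : ℝ}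
    (hp : 1 ≤ p) : 1 ≤ ∫ g, κ g ^ p ∂μ := by
  have h1 : ∀ g, 1 + p * (κ g - 1) ≤ κ g ^ p := fun g => by
    simpa using one_add_mul_self_le_rpow_one_add (s := κ g - 1) (by linarith [hκ.nonneg g]) hp
  have hi : Integrable (fun g => p * (κ g - 1)) μ :=
    (hκ.integrable.sub (integrable_const 1)).const_mul p
  have h2 := integral_mono ((integrable_const (1 : ℝ)).add hi)
    (hκ.integrable_rpow hM (by linarith)) h1
  have h3 : ∫ g, (κ g - 1) ∂μ = 0 := by
    rw [integral_sub hκ.integrable (integrable_const 1), hκ.integral_eq_one]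
    simp
  rw [integral_add' (integrable_const _) hi, integral_const_mul, h3] at h2
  simpa using h2

theorem integral_rpow_le (hκ : IsFixDensity S U κ) {M : ℝ} (hM : ∀ᵐ g ∂μ, κ g ≤ M) {p : ℝ}
    (hp : 1 < p) : ∫ g, κ g ^ p ∂μ ≤ M ^ (p - 1) := by
  have h := integral_mono_ae (hκ.integrable_rpow hM (by linarith : 0 ≤ p))
    (hκ.integrable.const_mul (M ^ (p - 1))) (hM.mono fun g hg => ?_)
  · rwa [integral_const_mul, hκ.integral_eq_one, mul_one] at h
  · rcases (hκ.nonneg g).eq_or_lt with h0 | h0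
    · simp [← h0, (by linarith : p ≠ 0)]
    · calc κ g ^ p = κ g ^ (p - 1) * κ g := by
            rw [← Real.rpow_add_one h0.ne', sub_add_cancel]
        _ ≤ M ^ (p - 1) * κ g := by
            exact mul_le_mul_of_nonneg_right (Real.rpow_le_rpow h0.le hg (by linarith)) h0.le

theorem integral_mul_log_le (hκ : IsFixDensity S U κ) {M : ℝ} (hM : ∀ᵐ g ∂μ, κ g ≤ M) :
    ∫ g, κ g * Real.log (κ g) ∂μ ≤ Real.log M := by
  have h := integral_mono_ae (hκ.hasDerivAt_integral_rpow hM (hκ.one_le_of_ae_le hM)).1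
    (hκ.integrable.mul_const (Real.log M)) (hM.mono fun g hg => ?_)
  · rwa [integral_mul_const, hκ.integral_eq_one, one_mul] at h
  · rcases (hκ.nonneg g).eq_or_lt with h0 | h0
    · simp [← h0]
    · exact mul_le_mul_of_nonneg_left (Real.log_le_log h0 hg) h0.le

/-- The power of σ is invariant and moves inside E and T, leaving the L_p inequalities for a ρ a. If
the support condition fails for ρ, it fails for both images and all terms are ⊤. -/
theorem sandwichedRenyi_bounds (hκ : IsFixDensity S U κ) {M : ℝ} (hM : ∀ᵐ g ∂μ, κ g ≤ M)
    {σ ρ : Matrix n n ℂ} (hσ : IsFixState S U σ) (hρ : ρ.PosSemidef) {p : ℝ} (hp : 1 < p) :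
    sandwichedRenyi p (Efix S U ρ) σ ≤ sandwichedRenyi p (actAverage μ U κ ρ) σ ∧
    sandwichedRenyi p (actAverage μ U κ ρ) σ ≤ sandwichedRenyi p (Efix S U ρ) σ +
      ((1 / (p - 1) * Real.log (∫ g, κ g ^ p ∂μ) : ℝ) : EReal) := by
  by_cases hker : KerLE σ ρ
  · have hkE := (kerLE_Efix_iff hσ hρ).2 hker
    have hkT := (hκ.kerLE_average_iff hσ hρ).2 hker
    simp only [sandwichedRenyi, if_pos hkE, if_pos hkT]
    set a := mpow σ ((1 - p) / (2 * p))
    have ha : ∀ g ∈ fixSet S U, U.act g a = a := fun g hg => U.act_cfc (hσ.act_eq hg) _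
    have hX : (a * ρ * a).PosSemidef := by
      have := hρ.conjTranspose_mul_mul_same a
      rwa [show aᴴ = a from (isHermitian_cfc σ _).eq] at this
    rw [← Efix_mul_mul ha, ← hκ.average_mul_mul ha ha, ← EReal.coe_add, EReal.coe_le_coe_iff,
      EReal.coe_le_coe_iff, ← mul_add]
    have h1 := trace_mpow_Efix_le (S := S) (U := U) (hκ.posSemidef_average hX) hp
    rw [hκ.Efix_average] at h1
    obtain ⟨h2, h3⟩ := log_le_log_and_log_le_add (trace_mpow_nonneg (posSemidef_Efix S U hX) p) h1
      (hκ.one_le_integral_rpow hM hp.le) (hκ.trace_mpow_average_le hM hX hp)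
    have hp1 : 0 ≤ 1 / (p - 1) := one_div_nonneg.2 (by linarith)
    exact ⟨mul_le_mul_of_nonneg_left h2 hp1, mul_le_mul_of_nonneg_left h3 hp1⟩
  · have hkE := mt (kerLE_Efix_iff hσ hρ).1 hker
    have hkT := mt (hκ.kerLE_average_iff hσ hρ).1 hker
    simp only [sandwichedRenyi, if_neg hkE, if_neg hkT, EReal.top_add_coe, le_refl, and_self]

theorem maxRenyi_bounds (hκ : IsFixDensity S U κ) {M : ℝ} (hM : ∀ᵐ g ∂μ, κ g ≤ M)
    {σ ρ : Matrix n n ℂ} (hσ : IsFixState S U σ) (hρ : ρ.PosSemidef) :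
    maxRenyi (Efix S U ρ) σ ≤ maxRenyi (actAverage μ U κ ρ) σ ∧
    maxRenyi (actAverage μ U κ ρ) σ ≤ maxRenyi (Efix S U ρ) σ + ((Real.log M : ℝ) : EReal) := by
  by_cases hker : KerLE σ ρ
  · have hkE := (kerLE_Efix_iff hσ hρ).2 hker
    have hkT := (hκ.kerLE_average_iff hσ hρ).2 hker
    simp only [maxRenyi, if_pos hkE, if_pos hkT]
    set a := mpow σ (-(1 / 2))
    have ha : ∀ g ∈ fixSet S U, U.act g a = a := fun g hg => U.act_cfc (hσ.act_eq hg) _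
    have hX : (a * ρ * a).PosSemidef := by
      have := hρ.conjTranspose_mul_mul_same a
      rwa [show aᴴ = a from (isHermitian_cfc σ _).eq] at this
    rw [← Efix_mul_mul ha, ← hκ.average_mul_mul ha ha, ← EReal.coe_add, EReal.coe_le_coe_iff,
      EReal.coe_le_coe_iff]
    have h1 := norm_Efix_le (S := S) (U := U) (actAverage μ U κ (a * ρ * a))
    rw [hκ.Efix_average] at h1
    have hM1 := hκ.one_le_of_ae_le hM
    exact log_le_log_and_log_le_add (norm_nonneg _) h1 hM1
      (hκ.norm_average_le hM (by linarith) hX)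
  · have hkE := mt (kerLE_Efix_iff hσ hρ).1 hker
    have hkT := mt (hκ.kerLE_average_iff hσ hρ).1 hker
    simp only [maxRenyi, if_neg hkE, if_neg hkT, EReal.top_add_coe, le_refl, and_self]

/-- Since log σ is invariant, Tr (· log σ) takes the same value on ρ, E ρ and T ρ; only the
entropies differ. -/
theorem relEntropy_bounds (hκ : IsFixDensity S U κ) {M : ℝ} (hM : ∀ᵐ g ∂μ, κ g ≤ M)
    {σ ρ : Matrix n n ℂ} (hσ : IsFixState S U σ) (hρ : IsState ρ) :
    relEntropy (Efix S U ρ) σ ≤ relEntropy (actAverage μ U κ ρ) σ ∧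
    relEntropy (actAverage μ U κ ρ) σ ≤ relEntropy (Efix S U ρ) σ +
      ((∫ g, κ g * Real.log (κ g) ∂μ : ℝ) : EReal) := by
  by_cases hker : KerLE σ ρ
  · have hkE := (kerLE_Efix_iff hσ hρ.1).2 hker
    have hkT := (hκ.kerLE_average_iff hσ hρ.1).2 hker
    simp only [relEntropy, if_pos hkE, if_pos hkT]
    have ha : ∀ g ∈ fixSet S U, U.act g (mlog σ) = mlog σ :=
      fun g hg => U.act_cfc (hσ.act_eq hg) _
    have h1 : (Efix S U ρ * mlog σ).trace = (mlog σ * ρ).trace := by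
      rw [Matrix.trace_mul_comm, trace_mul_Efix ha]
    have h2 : (actAverage μ U κ ρ * mlog σ).trace = (mlog σ * ρ).trace := by
      rw [Matrix.trace_mul_comm, hκ.trace_mul_average ha]
    rw [← EReal.coe_add, EReal.coe_le_coe_iff, EReal.coe_le_coe_iff, Matrix.mul_sub,
      Matrix.mul_sub, Matrix.trace_sub, Matrix.trace_sub, h1, h2, Complex.sub_re, Complex.sub_re]
    have h3 := entropy_Efix_le (S := S) (U := U) (hκ.posSemidef_average hρ.1)
    rw [hκ.Efix_average] at h3
    have h4 := hκ.entropy_average_le hM (hκ.one_le_of_ae_le hM) hρ.1 hρ.2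
    constructor <;> linarith
  · have hkE := mt (kerLE_Efix_iff hσ hρ.1).1 hker
    have hkT := mt (hκ.kerLE_average_iff hσ hρ.1).1 hker
    simp only [relEntropy, if_neg hkE, if_neg hkT, EReal.top_add_coe, le_refl, and_self]

theorem mul_log_eLpNorm (hκ : IsFixDensity S U κ) {M : ℝ} (hM : ∀ᵐ g ∂μ, κ g ≤ M) {p : ℝ}
    (hp : 1 < p) : ((p / (p - 1) : ℝ) : EReal) * ENNReal.log (eLpNorm κ (ENNReal.ofReal p) μ) =
      ((1 / (p - 1) * Real.log (∫ g, κ g ^ p ∂μ) : ℝ) : EReal) := by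
  have hp0 : 0 < p := by linarith
  have hbdd : ∀ᵐ g ∂μ, ‖κ g‖ ≤ M := hM.mono fun g hg => by
    rwa [Real.norm_of_nonneg (hκ.nonneg g)]
  have hmem : MemLp κ (ENNReal.ofReal p) μ :=
    MemLp.of_bound hκ.measurable.aestronglyMeasurable M hbdd
  have h1 := hmem.eLpNorm_eq_integral_rpow_norm (ENNReal.ofReal_pos.2 hp0).ne'
    ENNReal.ofReal_ne_top
  simp only [ENNReal.toReal_ofReal hp0.le, Real.norm_of_nonneg (hκ.nonneg _)] at h1
  have h2 : 0 < ∫ g, κ g ^ p ∂μ := one_pos.trans_le (hκ.one_le_integral_rpow hM hp.le)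
  rw [h1, ENNReal.log_ofReal_of_pos (Real.rpow_pos_of_pos h2 _), Real.log_rpow h2,
    ← EReal.coe_mul]
  congr 1
  field_simp

/-- The witness is the essential supremum itself, so the middle term of the p = ∞ chain is the norm
and not merely an upper bound for it. -/
theorem log_eLpNorm_top (hκ : IsFixDensity S U κ) {M : ℝ} (hM : ∀ᵐ g ∂μ, κ g ≤ M) :
    ∃ M' : ℝ, M' ≤ M ∧ (∀ᵐ g ∂μ, κ g ≤ M') ∧
      ENNReal.log (eLpNorm κ ∞ μ) = ((Real.log M' : ℝ) : EReal) := by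
  have hle : eLpNorm κ ∞ μ ≤ ENNReal.ofReal M := by
    rw [eLpNorm_exponent_top]
    exact eLpNormEssSup_le_of_ae_bound (hM.mono fun g hg => by
      rwa [Real.norm_of_nonneg (hκ.nonneg g)])
  have hne : eLpNorm κ ∞ μ ≠ ∞ := ne_top_of_le_ne_top ENNReal.ofReal_ne_top hle
  have hM' : ∀ᵐ g ∂μ, κ g ≤ (eLpNorm κ ∞ μ).toReal := by
    rw [eLpNorm_exponent_top] at hne ⊢
    filter_upwards [enorm_ae_le_eLpNormEssSup κ μ] with g hg
    have := ENNReal.toReal_mono hne hg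
    rwa [toReal_enorm, Real.norm_of_nonneg (hκ.nonneg g)] at this
  have h1 := hκ.one_le_of_ae_le hM'
  refine ⟨(eLpNorm κ ∞ μ).toReal, ?_, hM', ?_⟩
  · exact ENNReal.toReal_le_of_le_ofReal (by linarith [hκ.one_le_of_ae_le hM]) hle
  · rw [← ENNReal.log_ofReal_of_pos (by linarith), ENNReal.ofReal_toReal hne]

end IsFixDensity

theorem eLpNorm_comp_inv (k : G → ℝ) (hk : Measurable fun g => k g⁻¹) (p : ℝ≥0∞) :
    eLpNorm (fun g => k g⁻¹) p μ = eLpNorm k p μ := by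
  have : μ.IsInvInvariant := isInvInvariant_of_compact
  have hk' : Measurable k := by
    simpa [Function.comp_def] using hk.comp measurable_inv
  exact eLpNorm_comp_measurePreserving hk'.aestronglyMeasurable (Measure.measurePreserving_inv μ)

end divergences

end TransferredQMS

end

/-! ### The entropy comparison at the mixing time -/

theorem mainTheorem2 {G : Type*} [Group G] [TopologicalSpace G] [IsTopologicalGroup G]
    [CompactSpace G] [T2Space G] [SecondCountableTopology G] [MeasurableSpace G] [BorelSpace G]
    (μ : MeasureTheory.Measure G) [μ.IsHaarMeasure] [MeasureTheory.IsProbabilityMeasure μ]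
    {n : Type*} [Fintype n] [DecidableEq n]
    (S : TransferredQMS.MarkovSemigroup μ) (U : TransferredQMS.ProjectiveRep G n)
    (σ : Matrix n n ℂ) (hσ : TransferredQMS.IsFixState S U σ)
    (ρ : Matrix n n ℂ) (hρ : TransferredQMS.IsState ρ)
    (ε : ℝ) (hε : 0 < ε) (hfin : (S.mixingTimes ε).Nonempty) :
    let t : ℝ≥0 := S.tEps ε
    let Eρ := TransferredQMS.Efix S U ρ
    let Tρ := TransferredQMS.transferred S U t ρ
    -- the case `1 < p < ∞`
    (∀ p : ℝ, 1 < p →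
      TransferredQMS.sandwichedRenyi p Eρ σ ≤ TransferredQMS.sandwichedRenyi p Tρ σ ∧
      TransferredQMS.sandwichedRenyi p Tρ σ ≤ TransferredQMS.sandwichedRenyi p Eρ σ +
        ((p / (p - 1) : ℝ) : EReal) *
          ENNReal.log (MeasureTheory.eLpNorm (S.k t) (ENNReal.ofReal p) μ) ∧
      TransferredQMS.sandwichedRenyi p Eρ σ +
        ((p / (p - 1) : ℝ) : EReal) *
          ENNReal.log (MeasureTheory.eLpNorm (S.k t) (ENNReal.ofReal p) μ) ≤
        TransferredQMS.sandwichedRenyi p Eρ σ + ((Real.log (1 + ε) : ℝ) : EReal)) ∧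
    -- the case `p = 1`
    (TransferredQMS.relEntropy Eρ σ ≤ TransferredQMS.relEntropy Tρ σ ∧
      MeasureTheory.Integrable (fun g => S.k t g * Real.log (S.k t g)) μ ∧
      TransferredQMS.relEntropy Tρ σ ≤ TransferredQMS.relEntropy Eρ σ +
        ((∫ g, S.k t g * Real.log (S.k t g) ∂μ : ℝ) : EReal) ∧
      TransferredQMS.relEntropy Eρ σ +
        ((∫ g, S.k t g * Real.log (S.k t g) ∂μ : ℝ) : EReal) ≤
        TransferredQMS.relEntropy Eρ σ + ((Real.log (1 + ε) : ℝ) : EReal)) ∧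
    -- the case `p = ∞`
    (TransferredQMS.maxRenyi Eρ σ ≤ TransferredQMS.maxRenyi Tρ σ ∧
      TransferredQMS.maxRenyi Tρ σ ≤ TransferredQMS.maxRenyi Eρ σ +
        ENNReal.log (MeasureTheory.eLpNorm (S.k t) ∞ μ) ∧
      TransferredQMS.maxRenyi Eρ σ + ENNReal.log (MeasureTheory.eLpNorm (S.k t) ∞ μ) ≤
        TransferredQMS.maxRenyi Eρ σ + ((Real.log (1 + ε) : ℝ) : EReal)) := by
  intro t Eρ Tρ
  have hmix := TransferredQMS.tEps_mem_mixingTimes S hε hfin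
  have hκ := TransferredQMS.isFixDensity_k_inv_of_isKernelTime S U hmix.1
  have hM : ∀ᵐ g ∂μ, S.k t g⁻¹ ≤ 1 + ε :=
    ((TransferredQMS.ae_abs_sub_one_le_iff hε.le).1 hmix.2).mono fun g hg => by
      linarith [(abs_le.1 hg).2]
  have : μ.IsInvInvariant := TransferredQMS.isInvInvariant_of_compact
  have hT : Tρ = TransferredQMS.actAverage μ U (fun g => S.k t g⁻¹) ρ :=
    TransferredQMS.transferred_eq_of_isKernelTime S U hmix.1 ρ
  rw [hT]
  refine ⟨fun p hp => ?_, ?_, ?_⟩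
  · obtain ⟨h1, h2⟩ := hκ.sandwichedRenyi_bounds hM hσ hρ.1 hp
    rw [← TransferredQMS.eLpNorm_comp_inv (S.k t) hκ.measurable, hκ.mul_log_eLpNorm hM hp]
    refine ⟨h1, h2, add_le_add le_rfl (EReal.coe_le_coe_iff.2 ?_)⟩
    -- From κ^p ≤ (1+ε)^{p-1} κ one gets log ∫ κ^p ≤ (p-1) log(1+ε), and the prefactor 1/(p-1)
    -- cancels exactly.
    have h3 := Real.log_le_log (one_pos.trans_le (hκ.one_le_integral_rpow hM hp.le))
      (hκ.integral_rpow_le hM hp)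
    rw [Real.log_rpow (by linarith)] at h3
    rw [one_div, inv_mul_le_iff₀ (by linarith)]
    exact h3
  · obtain ⟨h1, h2⟩ := hκ.relEntropy_bounds hM hσ hρ
    have hint := (hκ.hasDerivAt_integral_rpow hM (hκ.one_le_of_ae_le hM)).1
    have hinv : ∫ g, S.k t g⁻¹ * Real.log (S.k t g⁻¹) ∂μ = ∫ g, S.k t g * Real.log (S.k t g) ∂μ :=
      integral_inv_eq_self (fun g => S.k t g * Real.log (S.k t g)) μ
    rw [hinv] at h2
    refine ⟨h1, by simpa using hint.comp_inv, h2,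
      add_le_add le_rfl (EReal.coe_le_coe_iff.2 ?_)⟩
    rw [← hinv]
    exact hκ.integral_mul_log_le hM
  · obtain ⟨M, hM1, hM2, hlog⟩ := hκ.log_eLpNorm_top hM
    obtain ⟨h1, h2⟩ := hκ.maxRenyi_bounds hM2 hσ hρ.1
    rw [← TransferredQMS.eLpNorm_comp_inv (S.k t) hκ.measurable, hlog]
    refine ⟨h1, h2, add_le_add le_rfl (EReal.coe_le_coe_iff.2 ?_)⟩
    exact Real.log_le_log (one_pos.trans_le (hκ.one_le_of_ae_le hM2)) hM1
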